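/- Let $D$ be a division algebra of degree $d$ with centre $C$ (so $[D:C]=d^2<\infty$), and let $\sigma$ be an automorphism of $D$ of finite inner order $n$: there is $u\in D^\times$ with $\sigma^n(x)=uxu^{-1}$ for all $x\in D$, and $\sigma^i$ is not an inner automorphism for $1\le i<n$. Choose $u$ so that $\sigma(u)=u$. Let $F=C\cap\mathrm{Fix}(\sigma)$ and let $R=D[t;\sigma]$ be the skew polynomial ring with $ta=\sigma(a)t$ for $a\in D$; its centre is $F[u^{-1}t^n]\cong F[x]$. Let $f\in R$ be monic of degree $m\ge 1$ such that the greatest common right divisor of $f$ and $t$ is $1$. Let $h(t)=\hat h(u^{-1}t^n)$, with $\hat h\in F[x]$ monic, be the minimal central left multiple of $f$, i.e. the nonzero central element of $R$ of least degree lying in $Rf$, normalised so that $\hat h$ is monic, and suppose that $\hat h$ is irreducible in $F[x]$. The eigenring of $f$ is $\mathcal E(f)=\{g\in R: fg\in Rf\}/Rf$, and $f$ is called a generalised A-polynomial if $\mathcal E(f)$ is a central simple algebra over $F$. For $c\in D^\times$ and $b\in D$ put $\Omega_c(b)=\sigma(c)\,b\,c^{-1}$. All products below are taken in the order of increasing index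 from left to right. Suppose that $n$ is prime and $n\ne d$. Then $f$ is a generalised A-polynomial if and only if one of the following holds: (i) there exists $a\in F^\times$ such that $ua\neq\prod_{j=1}^{n}\sigma^{n-j}(b)$ for every $b\in D$, and $f(t)=t^n-ua$; (ii) $m\le n$ and there exist $c_1,\dots,c_m,b\in D^\times$ with $c_m=1$ such that $u^{-1}\prod_{j=0}^{n-1}\sigma^{n-j}(b)\in F^\times$ and $f(t)=\prod_{i=1}^{m}(t-\Omega_{c_i}(b))$. Moreover, in case (i), $f$ is irreducible in $R$. -/

import Mathlib

/-!
The skew polynomial ring `D[t;σ]` is Mathlib's `SkewPolynomial D`: left coefficients, variable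
`t = SkewPolynomial.X`, multiplication rule `t * a = σ(a) * t`, where the twist `σ` is
`SkewPolynomial.φ`, the action of the generator of `Multiplicative ℕ` on `D`.
-/

namespace GenAPoly

noncomputable section

section Eigenring

variable (F : Type*) {R : Type*} [CommRing F] [Ring R] [Algebra F R]

/-- The left idealiser `{g ∈ R : f g ∈ R f}` of `f`, as an `F`-subalgebra of `R`.
(`Ideal.span {f}` is the left ideal `R f`.) -/
def idealiser (f : R) : Subalgebra F R where
  carrier := {g | f * g ∈ Ideal.span {f}}
  mul_mem' := by
    intro a b ha hb
    obtain ⟨r, hr⟩ := Ideal.mem_span_singleton'.1 ha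
    have h : f * (a * b) = r * (f * b) := by rw [← mul_assoc, ← hr, mul_assoc]
    rw [Set.mem_ofPred_eq, h]
    exact Ideal.mul_mem_left _ r hb
  add_mem' := by
    intro a b ha hb
    rw [Set.mem_ofPred_eq, mul_add]
    exact Ideal.add_mem _ ha hb
  algebraMap_mem' := by
    intro r
    rw [Set.mem_ofPred_eq, ← Algebra.commutes r f]
    exact Ideal.mul_mem_left _ _ (Ideal.mem_span_singleton_self f)

/-- The left ideal `R f`, seen inside the idealiser of `f`. -/
def eigenIdeal (f : R) : Ideal (idealiser F f) :=
  (Ideal.span {f}).comap (idealiser F f).val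

instance eigenIdeal_isTwoSided (f : R) : (eigenIdeal F f).IsTwoSided where
  mul_mem_of_left := by
    intro a b ha
    obtain ⟨r, hr⟩ := Ideal.mem_span_singleton'.1 (show (a : R) ∈ Ideal.span {f} from ha)
    have h : ((a * b : idealiser F f) : R) = r * (f * (b : R)) := by
      rw [← mul_assoc, hr]; rfl
    change ((a * b : idealiser F f) : R) ∈ Ideal.span {f}
    rw [h]
    exact Ideal.mul_mem_left _ r b.2

/-- The eigenring of `f`: the quotient of the idealiser of `f` by `R f`. -/
abbrev Eigenring (f : R) : Type _ := idealiser F f ⧸ eigenIdeal F f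

end Eigenring

/-- `A` is a (finite-dimensional) central simple algebra over the field `F`. -/
structure IsCentralSimpleAlgebra (F A : Type*) [Field F] [Ring A] [Algebra F A] : Prop where
  central : Algebra.IsCentral F A
  simple : IsSimpleRing A
  finite : FiniteDimensional F A

section Skew

/-- `τ` is an inner automorphism `x ↦ v x v⁻¹` of `D`. -/
def IsInner {D : Type*} [DivisionRing D] (τ : D → D) : Prop :=
  ∃ v : Dˣ, ∀ x, τ x = v * x * (v⁻¹ : Dˣ)

/-- `Ω_v(α) = σ(v) α v⁻¹`. -/
def Omega {D : Type*} [DivisionRing D] (σ : D ≃+* D) (v : Dˣ) (α : D) : D :=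
  σ v * α * (v⁻¹ : Dˣ)

/-- The degree of a skew polynomial, with `deg 0 = ⊥`. -/
def degree {D : Type*} [DivisionRing D] (p : SkewPolynomial D) : WithBot ℕ :=
  p.support.max

variable (C D : Type*) [Field C] [DivisionRing D] [Algebra C D]
  [MulSemiringAction (Multiplicative ℕ) D]

/-- The field `F = C ∩ Fix(σ)`, as a subfield of `C`, where `σ` is the twist of `D[t;σ]`. -/
def fixedField : Subfield C where
  carrier := {x | SkewPolynomial.φ (algebraMap C D x) = algebraMap C D x}
  mul_mem' := by
    intro a b ha hb
    rw [Set.mem_ofPred_eq] at *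
    rw [map_mul, map_mul, ha, hb]
  one_mem' := by rw [Set.mem_ofPred_eq, map_one, map_one]
  add_mem' := by
    intro a b ha hb
    rw [Set.mem_ofPred_eq] at *
    rw [map_add, map_add, ha, hb]
  zero_mem' := by rw [Set.mem_ofPred_eq, map_zero, map_zero]
  neg_mem' := by
    intro a ha
    rw [Set.mem_ofPred_eq] at *
    rw [map_neg, map_neg, ha]
  inv_mem' := by
    intro a ha
    rw [Set.mem_ofPred_eq] at *
    rw [map_inv₀, map_inv₀, ha]

/-- The twist is `F`-linear; this is what makes `D[t;σ]` an `F`-algebra in Mathlib. -/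
instance fixedField_smulCommClass :
    SMulCommClass (Multiplicative ℕ) (fixedField C D) D where
  smul_comm k r x := by
    have h : ∀ k : Multiplicative ℕ,
        k • algebraMap C D (r : C) = algebraMap C D (r : C) := by
      intro k
      have hk : k = Multiplicative.ofAdd (Multiplicative.toAdd k) := rfl
      rw [hk, ← SkewPolynomial.φ_iterate_apply]
      exact Function.iterate_fixed r.2 _
    change k • ((r : C) • x) = (r : C) • (k • x)
    rw [Algebra.smul_def, Algebra.smul_def, smul_mul', h]

variable {D}

/-- `f ∈ D[t;σ]` is a generalised A-polynomial: its eigenring is a central simple algebra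
over `F`. -/
def IsGeneralisedAPolynomial (f : SkewPolynomial D) : Prop :=
  IsCentralSimpleAlgebra (fixedField C D) (Eigenring (fixedField C D) f)

/-- The greatest common right divisor of `f` and `g` is `1`: every common right divisor is a
unit. -/
def RightCoprime (f g : SkewPolynomial D) : Prop :=
  ∀ q, (∃ a, f = a * q) → (∃ b, g = b * q) → IsUnit q

variable {C}

/-- The element `ĥ(u⁻¹ t^n)` of `D[t;σ]`, for `ĥ ∈ F[x]`. -/
def evalCentral (u : Dˣ) (n : ℕ) (hhat : Polynomial (fixedField C D)) : SkewPolynomial D :=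
  Polynomial.aeval
    (SkewPolynomial.C ((u⁻¹ : Dˣ) : D) * SkewPolynomial.X ^ n : SkewPolynomial D) hhat

/-- `ĥ ∈ F[x]` is monic and `h = ĥ(u⁻¹ t^n)` is the minimal central left multiple of `f`:
it is central, of the form `g f`, and of least degree among the nonzero central left multiples
of `f`. -/
structure IsMinCentralLeftMultiple (u : Dˣ) (n : ℕ) (f : SkewPolynomial D)
    (hhat : Polynomial (fixedField C D)) : Prop where
  monic : hhat.Monic
  central : evalCentral u n hhat ∈ Subring.center (SkewPolynomial D)
  leftMultiple : ∃ g, evalCentral u n hhat = g * f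
  minimal : ∀ q ∈ Subring.center (SkewPolynomial D), q ≠ 0 → (∃ g, q = g * f) →
    degree (evalCentral u n hhat) ≤ degree q

end Skew

end

end GenAPoly

/-
Let `R = D[t;σ]` and, for `a ∈ Fˣ`, let `h_a = u⁻¹tⁿ - a`. Since `h_a` is central and `R h_a` is a
maximal two-sided ideal, `R ⧸ R h_a` is a central simple `F`-algebra. If `f` right divides `h_a`,
the eigenring of `f` is opposite to the endomorphism ring of a module over this algebra, hence
central simple. Conversely, the class of the central element `u⁻¹tⁿ` lies in the centre of the
eigenring, so if that centre is `F` then `f` right divides some `h_a`, and `a ≠ 0` because `f` is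
coprime to `t`.

All simple modules over the simple ring `R ⧸ R h_a` have the same dimension over `D`, and this
dimension divides `n`. As `n` is prime, either `tⁿ - ua` is irreducible, or it has a right divisor
`t - b`, that is, `ua` is the `σ`-norm of `b`; in that case every monic right divisor of `h_a` is a
product of factors `t - Ω_c(b)`. Conversely, such a product of length `m` right divides `h_a ^ m`,
and the irreducibility of `ĥ` then makes it a right divisor of `h_a` itself.
-/

namespace GenAPoly

universe v

section CentralSimple

variable {K S M : Type*} [Field K] [Ring S] [Algebra K S] [AddCommGroup M] [Module S M]

theorem isSimpleRing_moduleEnd [IsSimpleRing S] [IsArtinianRing S] [Module.Finite S M]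
    [Nontrivial M] : IsSimpleRing (Module.End S M) := by
  obtain ⟨k, _, I, _, ⟨e⟩⟩ := (IsSimpleRing.isIsotypic S M).linearEquiv_fun
  classical
  exact IsSimpleRing.of_ringEquiv (e.conjRingEquiv.trans (endVecRingEquivMatrixEnd ..)).symm
    inferInstance

theorem isCentral_moduleEnd [IsSimpleRing S] [IsArtinianRing S] [Algebra.IsCentral K S]
    [Module K M] [IsScalarTower K S M] [Module.Finite K M] [Nontrivial M] :
    Algebra.IsCentral K (Module.End S M) where
  out c hc := by
    have : Module.Finite (Module.End S M) M := .of_restrictScalars_finite K _ _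
    let c' : Module.End (Module.End S M) M :=
      { toFun := c
        map_add' := map_add c
        map_smul' := fun g m =>
          LinearMap.congr_fun (Subalgebra.mem_center_iff.1 hc g).symm m }
    obtain ⟨s, hs⟩ := Module.Finite.toModuleEnd_moduleEnd_surjective c'
    have hsc (m : M) : s • m = c m := LinearMap.congr_fun hs m
    have hinj : Function.Injective (Module.toModuleEnd (S := S) (Module.End S M) M) :=
      RingHom.injective _
    have hs : s ∈ Subalgebra.center K S := Subalgebra.mem_center_iff.2 fun t =>
      hinj <| LinearMap.ext fun m => by
        change (t * s) • m = (s * t) • m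
        rw [mul_smul, mul_smul, hsc, hsc, map_smul]
    obtain ⟨a, rfl⟩ := Algebra.mem_bot.1 (Algebra.IsCentral.out hs)
    refine Algebra.mem_bot.2 ⟨a, LinearMap.ext fun m => ?_⟩
    rw [← hsc, algebraMap_smul, Module.algebraMap_end_apply]

namespace IsCentralSimpleAlgebra

variable {A B : Type v} [Ring A] [Algebra K A] [Ring B] [Algebra K B]

theorem of_algEquiv (hA : IsCentralSimpleAlgebra K A) (e : A ≃ₐ[K] B) :
    IsCentralSimpleAlgebra K B where
  central := have := hA.central; .of_algEquiv K A B e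
  simple := .of_ringEquiv e.toRingEquiv hA.simple
  finite := have := hA.finite; .equiv e.toLinearEquiv

theorem mulOpposite (hA : IsCentralSimpleAlgebra K A) : IsCentralSimpleAlgebra K Aᵐᵒᵖ where
  central := have := hA.central; inferInstance
  simple := have := hA.simple; ⟨TwoSidedIdeal.opOrderIso.symm.isSimpleOrder⟩
  finite := have := hA.finite; .equiv (MulOpposite.opLinearEquiv K)

theorem moduleEnd (hS : IsCentralSimpleAlgebra K S)
    [Module K M] [IsScalarTower K S M] [Module.Finite S M] [Nontrivial M] :
    IsCentralSimpleAlgebra K (Module.End S M) := by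
  have := hS.central
  have := hS.simple
  have := hS.finite
  have : IsArtinianRing S := .of_finite K S
  have : Module.Finite K M := .trans S M
  exact ⟨isCentral_moduleEnd, isSimpleRing_moduleEnd, inferInstance⟩

end IsCentralSimpleAlgebra

end CentralSimple

section Eigenring

variable {K : Type*} {R S : Type v} [Field K] [Ring R] [Algebra K R] [Ring S] [Algebra K S]

/-- For `g` in the idealiser of `f`, right multiplication by `π g` is an `S`-linear endomorphism
of `S ⧸ S (π f)`; it reverses products, hence the opposite ring. -/
def quotientMulRight (π : R →ₐ[K] S) (f : R) :
    idealiser K f →ₐ[K] (Module.End S (S ⧸ Ideal.span {π f}))ᵐᵒᵖ :=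
  AlgHom.ofLinearMap
    { toFun := fun g =>
        MulOpposite.op <| Submodule.mapQ _ _ (LinearMap.toSpanSingleton S S (π g)) <|
          (Ideal.span_singleton_le_iff_mem _).2 <| by
            obtain ⟨r, hr⟩ := Ideal.mem_span_singleton'.1 g.2
            exact Ideal.mem_span_singleton'.2 ⟨π r, by simp [← map_mul, hr]⟩
      map_add' := fun g g' => MulOpposite.unop_injective <| by ext; simp
      map_smul' := fun a g => MulOpposite.unop_injective <| by ext; simp }
    (MulOpposite.unop_injective <| by ext; simp)
    fun g g' => MulOpposite.unop_injective <| by ext; simp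

theorem quotientMulRight_eq_zero_iff {π : R →ₐ[K] S} {f : R} {g : idealiser K f} :
    quotientMulRight π f g = 0 ↔ π g ∈ Ideal.span {π f} := by
  refine ⟨fun h => ?_, fun h => MulOpposite.unop_injective ?_⟩
  · have h1 := LinearMap.congr_fun (congrArg MulOpposite.unop h) (Submodule.Quotient.mk 1)
    simpa [quotientMulRight, Submodule.Quotient.mk_eq_zero] using h1
  · ext
    simpa [quotientMulRight, Submodule.Quotient.mk_eq_zero] using h

theorem map_mem_span_singleton_iff {π : R →ₐ[K] S} (hπ : Function.Surjective π) {f : R}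
    (hker : RingHom.ker π ≤ Ideal.span {f}) {g : R} :
    π g ∈ Ideal.span {π f} ↔ g ∈ Ideal.span {f} := by
  rw [← Set.image_singleton, ← Ideal.map_span, ← Ideal.mem_comap,
    Ideal.comap_map_of_surjective π hπ]
  exact (sup_eq_left.2 hker).symm ▸ Iff.rfl

theorem quotientMulRight_surjective {π : R →ₐ[K] S} (hπ : Function.Surjective π) {f : R}
    (hker : RingHom.ker π ≤ Ideal.span {f}) : Function.Surjective (quotientMulRight π f) := by
  intro φ
  obtain ⟨s, hs⟩ := Submodule.Quotient.mk_surjective _ (φ.unop (Submodule.Quotient.mk 1))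
  obtain ⟨g, rfl⟩ := hπ s
  have hφ (s : S) : φ.unop (Submodule.Quotient.mk s) = Submodule.Quotient.mk (s * π g) := by
    rw [← mul_one s, ← smul_eq_mul, Submodule.Quotient.mk_smul, map_smul, ← hs, smul_eq_mul,
      mul_one, ← Submodule.Quotient.mk_smul, smul_eq_mul]
  have hg : g ∈ idealiser K f := by
    have h : φ.unop (Submodule.Quotient.mk (π f)) = 0 := by
      rw [(Submodule.Quotient.mk_eq_zero _).2 (Ideal.mem_span_singleton_self _), map_zero]
    rw [hφ, Submodule.Quotient.mk_eq_zero, ← map_mul] at h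
    exact (map_mem_span_singleton_iff hπ hker).1 h
  refine ⟨⟨g, hg⟩, MulOpposite.unop_injective ?_⟩
  ext
  simp [quotientMulRight, hφ]

/-- The eigenring of `f` is the opposite of the endomorphism ring of `R ⧸ R f`, which may be
computed over any quotient `S` of `R` acting on that module. -/
noncomputable def eigenringAlgEquiv {π : R →ₐ[K] S} (hπ : Function.Surjective π) {f : R}
    (hker : RingHom.ker π ≤ Ideal.span {f}) :
    Eigenring K f ≃ₐ[K] (Module.End S (S ⧸ Ideal.span {π f}))ᵐᵒᵖ :=
  have hmem (g : idealiser K f) : g ∈ eigenIdeal K f ↔ quotientMulRight π f g = 0 :=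
    ((map_mem_span_singleton_iff hπ hker).symm.trans quotientMulRight_eq_zero_iff.symm)
  AlgEquiv.ofBijective
    (Ideal.Quotient.liftₐ (eigenIdeal K f) (quotientMulRight π f) fun g => (hmem g).1)
    ⟨(injective_iff_map_eq_zero _).2 fun x => by
        obtain ⟨g, rfl⟩ := Ideal.Quotient.mk_surjective x
        exact fun h => Ideal.Quotient.eq_zero_iff_mem.2 ((hmem g).2 h),
      Ideal.Quotient.lift_surjective_of_surjective _ _ (quotientMulRight_surjective hπ hker)⟩

theorem isCentralSimpleAlgebra_eigenring (hS : IsCentralSimpleAlgebra K S) {π : R →ₐ[K] S}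
    (hπ : Function.Surjective π) {f : R} (hker : RingHom.ker π ≤ Ideal.span {f})
    (hf : Ideal.span {f} ≠ ⊤) : IsCentralSimpleAlgebra K (Eigenring K f) := by
  have : Nontrivial (S ⧸ Ideal.span {π f}) := Submodule.Quotient.nontrivial_iff.2 <|
    (Ideal.ne_top_iff_one _).2 <| by
      rwa [← map_one π, map_mem_span_singleton_iff hπ hker, ← Ideal.ne_top_iff_one]
  exact (hS.moduleEnd.mulOpposite).of_algEquiv (eigenringAlgEquiv hπ hker).symm

end Eigenring

open SkewPolynomial
open Finset.HasAntidiagonal (antidiagonal mem_antidiagonal)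

section Degree

variable {D : Type*} [DivisionRing D] {p q : SkewPolynomial D} {k l : ℕ}

theorem degree_lt_iff : degree p < k ↔ ∀ i, k ≤ i → p.coeff i = 0 := by
  rw [degree, Finset.max_eq_sup_coe]
  refine (Finset.sup_lt_iff (WithBot.bot_lt_coe k)).trans <| forall_congr' fun i => ?_
  rw [mem_support_iff, WithBot.coe_lt_coe, ← not_le, not_imp_not]

theorem degree_le_iff : degree p ≤ k ↔ ∀ i, k < i → p.coeff i = 0 := by
  refine Finset.max_le_iff.trans <| forall_congr' fun i => ?_
  refine (imp_congr mem_support_iff WithBot.coe_le_coe).trans ?_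
  rw [← not_lt, not_imp_not]
  rfl

theorem degree_eq_iff : degree p = k ↔ degree p ≤ k ∧ p.coeff k ≠ 0 :=
  ⟨fun h => ⟨h.le, mem_support_iff.1 (Finset.mem_of_max h)⟩,
    fun h => h.1.antisymm (Finset.le_max (mem_support_iff.2 h.2))⟩

theorem degree_eq_bot : degree p = ⊥ ↔ p = 0 := by
  rw [degree, Finset.max_eq_bot, support_eq_empty]

theorem exists_degree_eq (hp : p ≠ 0) : ∃ k : ℕ, degree p = k :=
  (WithBot.ne_bot_iff_exists.1 (mt degree_eq_bot.1 hp)).imp fun _ h => h.symm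

theorem zero_le_degree (hp : p ≠ 0) : 0 ≤ degree p := by
  obtain ⟨k, hk⟩ := exists_degree_eq hp
  exact hk ▸ Nat.cast_nonneg k

theorem ne_zero_of_degree_eq (h : degree p = k) : p ≠ 0 :=
  mt degree_eq_bot.2 <| h ▸ WithBot.natCast_ne_bot k

theorem degree_monomial {c : D} (hc : c ≠ 0) : degree (monomial k c) = k := by
  rw [degree, support_monomial k hc, Finset.max_singleton]
  rfl

theorem eq_C_of_degree_le_zero (h : degree p ≤ 0) : p = C (p.coeff 0) := by
  ext i
  cases i with
  | zero => rw [coeff_C_zero]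
  | succ i => rw [coeff_C_succ, degree_le_iff.1 h _ i.succ_pos]

theorem degree_sub_lt (hp : degree p = k) (hq : degree q = k) (h : p.coeff k = q.coeff k) :
    degree (p - q) < k := by
  refine degree_lt_iff.2 fun i hi => ?_
  rw [coeff_sub]
  rcases hi.eq_or_lt with rfl | hi
  · rw [h, sub_self]
  · rw [degree_le_iff.1 hp.le i hi, degree_le_iff.1 hq.le i hi, sub_zero]

/-- `p` is monic of degree `k`. -/
def IsMonicOfDegree (p : SkewPolynomial D) (k : ℕ) : Prop :=
  degree p = k ∧ p.coeff k = 1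

theorem isMonicOfDegree_iff : IsMonicOfDegree p k ↔ degree p ≤ k ∧ p.coeff k = 1 :=
  ⟨fun h => ⟨h.1.le, h.2⟩, fun h => ⟨degree_eq_iff.2 ⟨h.1, h.2 ▸ one_ne_zero⟩, h.2⟩⟩

theorem IsMonicOfDegree.ne_zero (hp : IsMonicOfDegree p k) : p ≠ 0 :=
  ne_zero_of_degree_eq hp.1

theorem isMonicOfDegree_zero_iff : IsMonicOfDegree p 0 ↔ p = 1 := by
  refine ⟨fun h => ?_, ?_⟩
  · rw [eq_C_of_degree_le_zero h.1.le, h.2, C_1]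
  · rintro rfl
    exact ⟨degree_monomial one_ne_zero, coeff_one_zero⟩

end Degree

section Multiplication

variable {D : Type*} [DivisionRing D] [MulSemiringAction (Multiplicative ℕ) D]
  {p q : SkewPolynomial D} {k l : ℕ}

theorem coeff_mul_antidiagonal (p q : SkewPolynomial D) (k : ℕ) :
    (p * q).coeff k = ∑ x ∈ antidiagonal k, p.coeff x.1 * φ^[x.1] (q.coeff x.2) := by
  classical
  have h := SkewMonoidAlgebra.coeff_mul_antidiagonal_of_finset p q (Multiplicative.ofAdd k)
    ((antidiagonal k).map
      (Equiv.prodCongr Multiplicative.ofAdd Multiplicative.ofAdd).toEmbedding) fun {x} => by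
      rw [Finset.mem_map_equiv, mem_antidiagonal, ← Multiplicative.ofAdd.injective.eq_iff]
      rfl
  rw [Finset.sum_map] at h
  simp only [φ_iterate_apply]
  exact h

theorem coeff_C_mul (y : D) (p : SkewPolynomial D) (i : ℕ) : (C y * p).coeff i = y * p.coeff i :=
  SkewMonoidAlgebra.coeff_single_one_mul p y _

theorem coeff_mul_C (p : SkewPolynomial D) (y : D) (i : ℕ) :
    (p * C y).coeff i = p.coeff i * φ^[i] y := by
  rw [φ_iterate_apply]
  exact SkewMonoidAlgebra.coeff_mul_single_one p y _

theorem coeff_mul_add_of_degree_le (hp : degree p ≤ k) (hq : degree q ≤ l) :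
    (p * q).coeff (k + l) = p.coeff k * φ^[k] (q.coeff l) := by
  rw [degree_le_iff] at hp hq
  rw [coeff_mul_antidiagonal, Finset.sum_eq_single_of_mem (k, l) (mem_antidiagonal.2 rfl)]
  rintro ⟨i, j⟩ hij hne
  rw [mem_antidiagonal] at hij
  rcases lt_trichotomy i k with h | rfl | h
  · rw [hq j (by omega), iterate_map_zero, mul_zero]
  · exact absurd (congrArg (Prod.mk i) (Nat.add_left_cancel hij)) hne
  · rw [hp i h, zero_mul]

theorem degree_mul_le (hp : degree p ≤ k) (hq : degree q ≤ l) :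
    degree (p * q) ≤ (k + l : ℕ) := by
  rw [degree_le_iff] at hp hq ⊢
  intro i hi
  rw [coeff_mul_antidiagonal]
  refine Finset.sum_eq_zero fun x hx => ?_
  rw [mem_antidiagonal] at hx
  rcases lt_or_ge k x.1 with h | h
  · rw [hp _ h, zero_mul]
  · rw [hq x.2 (by omega), iterate_map_zero, mul_zero]

theorem phi_iterate_ne_zero (k : ℕ) {c : D} (hc : c ≠ 0) : φ^[k] c ≠ 0 :=
  (iterate_map_zero (φ : D →+* D) k).symm ▸ ((φ : D →+* D).injective.iterate k).ne hc

theorem degree_mul (p q : SkewPolynomial D) : degree (p * q) = degree p + degree q := by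
  rcases eq_or_ne p 0 with rfl | hp
  · rw [zero_mul, degree_eq_bot.2 rfl, WithBot.bot_add]
  rcases eq_or_ne q 0 with rfl | hq
  · rw [mul_zero, degree_eq_bot.2 rfl, WithBot.add_bot]
  obtain ⟨k, hk⟩ := exists_degree_eq hp
  obtain ⟨l, hl⟩ := exists_degree_eq hq
  rw [hk, hl, ← Nat.cast_add, degree_eq_iff, coeff_mul_add_of_degree_le hk.le hl.le]
  exact ⟨degree_mul_le hk.le hl.le,
    mul_ne_zero (degree_eq_iff.1 hk).2 (phi_iterate_ne_zero k (degree_eq_iff.1 hl).2)⟩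

instance : NoZeroDivisors (SkewPolynomial D) where
  eq_zero_or_eq_zero_of_mul_eq_zero {p q} h := by
    rwa [← degree_eq_bot, degree_mul, WithBot.add_eq_bot, degree_eq_bot, degree_eq_bot] at h

instance : IsDomain (SkewPolynomial D) := NoZeroDivisors.to_isDomain _

theorem IsMonicOfDegree.of_mul_right (hpq : IsMonicOfDegree (p * q) (k + l))
    (hq : IsMonicOfDegree q l) : IsMonicOfDegree p k := by
  have hp : degree p = k := by
    have h := hpq.1
    rw [degree_mul, hq.1, Nat.cast_add] at h
    exact WithBot.add_right_cancel (WithBot.natCast_ne_bot l) h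
  refine ⟨hp, ?_⟩
  simpa only [coeff_mul_add_of_degree_le hp.le hq.1.le, hq.2, iterate_map_one, mul_one]
    using hpq.2

theorem isUnit_C {c : D} (hc : c ≠ 0) : IsUnit (C c : SkewPolynomial D) :=
  (IsUnit.mk0 c hc).map (CRingHom : D →+* SkewPolynomial D)

theorem isUnit_iff_degree_eq_zero : IsUnit p ↔ degree p = 0 := by
  refine ⟨fun ⟨v, hv⟩ => ?_, fun h => ?_⟩
  · have h : degree (v : SkewPolynomial D) + degree (↑v⁻¹ : SkewPolynomial D) = 0 := by
      rw [← degree_mul, Units.mul_inv]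
      exact (isMonicOfDegree_zero_iff.2 rfl).1
    obtain ⟨k, hk⟩ := exists_degree_eq v.ne_zero
    obtain ⟨l, hl⟩ := exists_degree_eq v⁻¹.ne_zero
    rw [hk, hl] at h
    norm_cast at h
    rw [← hv, hk, (add_eq_zero.1 h).1, Nat.cast_zero]
  · rw [eq_C_of_degree_le_zero h.le]
    exact isUnit_C (degree_eq_iff.1 h).2

theorem not_isUnit_of_degree_eq (hp : degree p = k) (hk : 0 < k) : ¬ IsUnit p := by
  rw [isUnit_iff_degree_eq_zero, hp, Nat.cast_eq_zero]
  exact hk.ne'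

theorem X_pow_mul_C (k : ℕ) (b : D) : (X : SkewPolynomial D) ^ k * C b = C (φ^[k] b) * X ^ k := by
  rw [C_mul_X_pow_eq_monomial, ← monomial_one_right_eq_X_pow, monomial_mul_C, one_mul]

theorem X_mul_C (b : D) : (X : SkewPolynomial D) * C b = C (φ b) * X := by
  simpa only [pow_one, Function.iterate_one] using X_pow_mul_C 1 b

theorem isMonicOfDegree_X_pow_sub_C (hk : 0 < k) (c : D) :
    IsMonicOfDegree (X ^ k - C c : SkewPolynomial D) k := by
  simp only [isMonicOfDegree_iff, degree_le_iff, ← monomial_one_right_eq_X_pow, coeff_sub,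
    coeff_monomial, coeff_C]
  refine ⟨fun i hi => ?_, ?_⟩
  · rw [if_neg hi.ne, if_neg (hk.trans hi).ne', sub_zero]
  · rw [if_pos trivial, if_neg hk.ne', sub_zero]

theorem isMonicOfDegree_X_sub_C (b : D) : IsMonicOfDegree (X - C b : SkewPolynomial D) 1 := by
  simpa only [pow_one] using isMonicOfDegree_X_pow_sub_C one_pos b

end Multiplication

section LeftIdeal

variable {D : Type*} [DivisionRing D] [MulSemiringAction (Multiplicative ℕ) D]
  {p q w : SkewPolynomial D} {k l : ℕ}

theorem degree_le_degree_of_mem_span (hw : w ∈ Ideal.span {p}) (h0 : w ≠ 0) :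
    degree p ≤ degree w := by
  obtain ⟨s, rfl⟩ := Ideal.mem_span_singleton'.1 hw
  rw [degree_mul]
  exact le_add_of_nonneg_left (zero_le_degree (left_ne_zero_of_mul h0))

theorem eq_zero_of_mem_span_of_degree_lt (hw : w ∈ Ideal.span {p}) (h : degree w < degree p) :
    w = 0 :=
  by_contra fun h0 => h.not_ge (degree_le_degree_of_mem_span hw h0)

theorem IsMonicOfDegree.eq_of_mem_span (hq : IsMonicOfDegree q k) (hp : IsMonicOfDegree p k)
    (h : q ∈ Ideal.span {p}) : q = p := by
  refine sub_eq_zero.1 <| eq_zero_of_mem_span_of_degree_lt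
    (Ideal.sub_mem _ h (Ideal.mem_span_singleton_self p)) ?_
  rw [hp.1]
  exact degree_sub_lt hq.1 hp.1 (hq.2.trans hp.2.symm)

theorem exists_degree_sub_mul_lt_self (hq : q ≠ 0) (hp : p ≠ 0) (h : degree q ≤ degree p) :
    ∃ s, degree (p - s * q) < degree p := by
  obtain ⟨k, hk⟩ := exists_degree_eq hp
  obtain ⟨l, hl⟩ := exists_degree_eq hq
  rw [hk, hl, Nat.cast_le] at h
  obtain ⟨j, rfl⟩ := Nat.exists_eq_add_of_le' h
  have hql := phi_iterate_ne_zero j (degree_eq_iff.1 hl).2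
  have hs : degree (monomial j (p.coeff (j + l) * (φ^[j] (q.coeff l))⁻¹)) = j :=
    degree_monomial (mul_ne_zero (degree_eq_iff.1 hk).2 (inv_ne_zero hql))
  refine ⟨_, hk ▸ degree_sub_lt hk (by rw [degree_mul, hs, hl, Nat.cast_add]) ?_⟩
  rw [coeff_mul_add_of_degree_le hs.le hl.le, coeff_monomial, if_pos rfl,
    inv_mul_cancel_right₀ hql]

theorem exists_degree_sub_mul_lt (hq : q ≠ 0) (p : SkewPolynomial D) :
    ∃ s, degree (p - s * q) < degree q := by
  by_contra! h
  let s := Function.argmin fun s => degree (p - s * q)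
  have hs : p - s * q ≠ 0 := fun h0 =>
    hq <| degree_eq_bot.1 <| le_bot_iff.1 <| (h s).trans_eq <| degree_eq_bot.2 h0
  obtain ⟨r, hr⟩ := exists_degree_sub_mul_lt_self hq hs (h s)
  rw [sub_sub, ← add_mul] at hr
  exact Function.not_lt_argmin (fun s => degree (p - s * q)) (s + r) hr

theorem exists_isMonicOfDegree_span_eq {I : Ideal (SkewPolynomial D)} (hI : I ≠ ⊥) :
    ∃ k q, IsMonicOfDegree q k ∧ I = Ideal.span {q} := by
  obtain ⟨q, ⟨hqI, hq0⟩, hmin⟩ := exists_minimalFor_of_wellFoundedLT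
    (fun q => q ∈ I ∧ q ≠ 0) degree (Submodule.exists_mem_ne_zero_of_ne_bot hI)
  have hspan : I = Ideal.span {q} := by
    refine le_antisymm (fun p hp => ?_) ((Ideal.span_singleton_le_iff_mem I).2 hqI)
    obtain ⟨s, hs⟩ := exists_degree_sub_mul_lt hq0 p
    refine Ideal.mem_span_singleton'.2 ⟨s, (sub_eq_zero.1 ?_).symm⟩
    by_contra h0
    exact hs.not_ge (hmin ⟨Ideal.sub_mem _ hp (Ideal.mul_mem_left _ s hqI), h0⟩ hs.le)
  obtain ⟨k, hk⟩ := exists_degree_eq hq0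
  have hc := (degree_eq_iff.1 hk).2
  refine ⟨k, C (q.coeff k)⁻¹ * q, ⟨?_, ?_⟩, ?_⟩
  · rw [degree_mul, isUnit_iff_degree_eq_zero.1 (isUnit_C (inv_ne_zero hc)), zero_add, hk]
  · rw [coeff_C_mul, inv_mul_cancel₀ hc]
  · rw [Ideal.span_singleton_mul_left_unit (isUnit_C (inv_ne_zero hc)), hspan]

theorem exists_mul_mem_span (hp : p ≠ 0) (w : SkewPolynomial D) :
    ∃ s, s ≠ 0 ∧ degree s ≤ degree p ∧ s * w ∈ Ideal.span {p} := by
  induction hd : degree p using WellFoundedLT.induction generalizing p w with | _ _ ih => ?_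
  subst hd
  obtain ⟨q, hr⟩ := exists_degree_sub_mul_lt hp w
  rcases eq_or_ne (w - q * p) 0 with h0 | h0
  · refine ⟨1, one_ne_zero, ?_, ?_⟩
    · exact (isUnit_iff_degree_eq_zero.1 isUnit_one).trans_le (zero_le_degree hp)
    · exact Ideal.mem_span_singleton'.2 ⟨q, by rw [one_mul, sub_eq_zero.1 h0]⟩
  · obtain ⟨s, hs0, hs, hsp⟩ := ih _ hr h0 p rfl
    obtain ⟨s', hs'⟩ := Ideal.mem_span_singleton'.1 hsp
    have hs'0 : s' ≠ 0 := left_ne_zero_of_mul (hs'.trans_ne (mul_ne_zero hs0 hp))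
    refine ⟨s', hs'0, ?_, ?_⟩
    · refine (WithBot.add_le_add_iff_right (mt degree_eq_bot.1 h0)).1 ?_
      rw [← degree_mul, hs', degree_mul, add_comm (degree p)]
      gcongr
    · rw [mul_sub, sub_eq_iff_eq_add] at hs'
      rw [hs']
      exact Ideal.add_mem _ (Ideal.mem_span_singleton'.2 ⟨_, rfl⟩)
        (Ideal.mem_span_singleton'.2 ⟨_, mul_assoc _ _ _⟩)

end LeftIdeal

section CentralMaximal

variable {R : Type*} [Ring R] {h p q : R} {L : Ideal R}

theorem span_singleton_eq_top_iff [IsDedekindFiniteMonoid R] :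
    Ideal.span {p} = ⊤ ↔ IsUnit p := by
  rw [Ideal.eq_top_iff_one, Ideal.mem_span_singleton']
  exact ⟨fun ⟨s, hs⟩ => .of_mul_eq_one_right s hs, fun h => h.exists_left_inv⟩

theorem isTwoSided_span_singleton (hh : h ∈ Subring.center R) : (Ideal.span {h}).IsTwoSided where
  mul_mem_of_left {p} q hp := by
    obtain ⟨s, rfl⟩ := Ideal.mem_span_singleton'.1 hp
    rw [mul_assoc, ← Subring.mem_center_iff.1 hh, ← mul_assoc]
    exact Ideal.mem_span_singleton'.2 ⟨_, rfl⟩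

theorem mul_comm_of_mul_mem_center [NoZeroDivisors R] (hpq : p * q ∈ Subring.center R) :
    p * q = q * p := by
  rcases eq_or_ne q 0 with rfl | hq
  · rw [mul_zero, zero_mul]
  · refine mul_right_cancel₀ hq ?_
    rw [← Subring.mem_center_iff.1 hpq, mul_assoc]

theorem mem_span_of_mem_span_mul [NoZeroDivisors R] (hh : h ∈ Subring.center R)
    (hpq : h ∈ Ideal.span {p * q}) : h ∈ Ideal.span {p} := by
  obtain ⟨s, rfl⟩ := Ideal.mem_span_singleton'.1 hpq
  rw [← mul_assoc] at hh ⊢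
  rw [mul_comm_of_mul_mem_center hh, ← mul_assoc]
  exact Ideal.mem_span_singleton'.2 ⟨_, rfl⟩

theorem pow_length_mem_span_prod (hh : h ∈ Subring.center R) (l : List R)
    (hl : ∀ p ∈ l, h ∈ Ideal.span {p}) : h ^ l.length ∈ Ideal.span {l.prod} := by
  induction l with
  | nil =>
    rw [List.length_nil, pow_zero, List.prod_nil]
    exact Ideal.mem_span_singleton_self 1
  | cons p l ih =>
    obtain ⟨g, hg⟩ := Ideal.mem_span_singleton'.1 (ih fun q hq => hl q (.tail p hq))
    obtain ⟨s, hs⟩ := Ideal.mem_span_singleton'.1 (hl p (.head l))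
    refine Ideal.mem_span_singleton'.2 ⟨g * s, ?_⟩
    rw [List.prod_cons, List.length_cons, pow_succ, ← hg, mul_assoc g s, ← mul_assoc s p, hs,
      mul_assoc g, Subring.mem_center_iff.1 hh]

/-- `h` is central and `R h` is a maximal two-sided ideal, that is, `R ⧸ R h` is a simple ring. -/
structure IsCentralMaximal (h : R) : Prop where
  mem_center : h ∈ Subring.center R
  span_ne_top : Ideal.span {h} ≠ ⊤
  eq_or_eq_top : ∀ I : Ideal R, I.IsTwoSided → h ∈ I → I = Ideal.span {h} ∨ I = ⊤

namespace IsCentralMaximal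

theorem isSimpleRing (hh : IsCentralMaximal h) [(Ideal.span {h}).IsTwoSided] :
    IsSimpleRing (R ⧸ Ideal.span {h}) := by
  have : Nontrivial (R ⧸ Ideal.span {h}) := Ideal.Quotient.nontrivial_iff.2 hh.span_ne_top
  refine isSimpleRing_iff_isTwoSided_imp.2 ⟨this, fun J _ => ?_⟩
  have hmk := Ideal.comap_injective_of_surjective _ (Ideal.Quotient.mk_surjective (I := .span {h}))
  have hJ : h ∈ J.comap (Ideal.Quotient.mk (.span {h})) := by
    rw [Ideal.mem_comap, Ideal.Quotient.eq_zero_iff_mem.2 (Ideal.mem_span_singleton_self h)]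
    exact zero_mem J
  rcases hh.eq_or_eq_top _ inferInstance hJ with h | h
  · exact .inl (hmk (by rw [h, ← RingHom.ker_eq_comap_bot, Ideal.mk_ker]))
  · exact .inr (hmk (by rw [h, Ideal.comap_top]))

theorem exists_mul_notMem (hh : IsCentralMaximal h) (hL : h ∈ L) (hL1 : L ≠ ⊤)
    (hp : p ∉ Ideal.span {h}) : ∃ w, p * w ∉ L := by
  contrapose! hp
  have hann (r : R) : r ∈ Module.annihilator R (R ⧸ L) ↔ ∀ w, r * w ∈ L :=
    Module.mem_annihilator.trans <| (Submodule.mkQ_surjective L).forall.trans <|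
      forall_congr' fun _ => Submodule.Quotient.mk_eq_zero L
  have hmem : h ∈ Module.annihilator R (R ⧸ L) := (hann h).2 fun w => by
    rw [← Subring.mem_center_iff.1 hh.mem_center]
    exact L.mul_mem_left w hL
  have htop : Module.annihilator R (R ⧸ L) ≠ ⊤ := by
    rwa [Ne, Module.annihilator_eq_top_iff, Submodule.Quotient.subsingleton_iff]
  rw [← (hh.eq_or_eq_top _ inferInstance hmem).resolve_right htop, hann]
  exact hp

theorem exists_notMem_mul_mem [IsDomain R] (hh : IsCentralMaximal h) (h0 : h ≠ 0)
    (hL : h ∈ L) (hL1 : L ≠ ⊤) (hp : h ∈ Ideal.span {p}) (hp1 : ¬ IsUnit p) :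
    ∃ w ∉ L, p * w ∈ L := by
  obtain ⟨g, rfl⟩ := Ideal.mem_span_singleton'.1 hp
  have hcomm := mul_comm_of_mul_mem_center hh.mem_center
  have hg : g ∉ Ideal.span {g * p} := fun hg => by
    obtain ⟨s, hs⟩ := Ideal.mem_span_singleton'.1 hg
    refine hp1 (.of_mul_eq_one_right s (mul_right_cancel₀ (left_ne_zero_of_mul h0) ?_))
    rw [one_mul, mul_assoc, ← hcomm, hs]
  obtain ⟨w, hw⟩ := hh.exists_mul_notMem hL hL1 hg
  refine ⟨g * w, hw, ?_⟩
  rw [← mul_assoc, ← hcomm, ← Subring.mem_center_iff.1 hh.mem_center]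
  exact L.mul_mem_left w hL

end IsCentralMaximal

end CentralMaximal

section LinearFactor

variable {D : Type*} [DivisionRing D] [MulSemiringAction (Multiplicative ℕ) D]
  {p q : SkewPolynomial D} {k : ℕ}

theorem exists_sub_C_mem_span (b : D) (p : SkewPolynomial D) :
    ∃ c, p - C c ∈ Ideal.span {X - C b} := by
  have hb := isMonicOfDegree_X_sub_C b
  obtain ⟨s, hs⟩ := exists_degree_sub_mul_lt hb.ne_zero p
  rw [hb.1, degree_lt_iff] at hs
  exact ⟨_, Ideal.mem_span_singleton'.2
    ⟨s, by rw [← eq_C_of_degree_le_zero (degree_le_iff.2 hs), sub_sub_cancel]⟩⟩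

theorem IsMonicOfDegree.eq_X_sub_C (hp : IsMonicOfDegree p 1) : p = X - C (-p.coeff 0) := by
  ext i
  rw [coeff_sub, C_neg, coeff_neg, sub_neg_eq_add]
  match i with
  | 0 => rw [coeff_X_zero, zero_add, coeff_C_zero]
  | 1 => rw [hp.2, coeff_X_one, coeff_C_succ, add_zero]
  | i + 2 =>
    rw [coeff_X_of_ne_one (by omega), coeff_C_succ, add_zero,
      degree_le_iff.1 hp.1.le _ (by omega)]

theorem RightCoprime.coeff_zero_ne_zero (hp : RightCoprime p X) : p.coeff 0 ≠ 0 := by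
  intro h0
  have hX : IsMonicOfDegree (X : SkewPolynomial D) 1 := by
    simpa only [C_0, sub_zero] using isMonicOfDegree_X_sub_C (0 : D)
  obtain ⟨c, hc⟩ := exists_sub_C_mem_span 0 p
  rw [C_0, sub_zero, Ideal.mem_span_singleton'] at hc
  obtain ⟨s, hs⟩ := hc
  have hc0 : c = 0 := by
    have := congrArg (coeff · 0) hs
    simpa [coeff_mul_antidiagonal, h0] using this
  have hpX : p = s * X := by rw [hs, hc0, C_0, sub_zero]
  exact not_isUnit_of_degree_eq hX.1 one_pos (hp X ⟨s, hpX⟩ ⟨1, (one_mul X).symm⟩)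

theorem coeff_eq_zero_of_coeff_mul_eq_zero (h0 : p.coeff 0 ≠ 0)
    (h : ∀ i < k, (q * p).coeff i = 0) {i : ℕ} (hi : i < k) : q.coeff i = 0 := by
  induction i using Nat.strong_induction_on with | _ i ih => ?_
  have hsum := h i hi
  rw [coeff_mul_antidiagonal,
    Finset.sum_eq_single_of_mem (i, 0) (mem_antidiagonal.2 (add_zero i))] at hsum
  · exact (mul_eq_zero_iff_right (phi_iterate_ne_zero i h0)).1 hsum
  · rintro ⟨x, y⟩ hxy hne
    rw [mem_antidiagonal] at hxy
    have hxi : x ≠ i := by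
      rintro rfl
      exact hne (Prod.ext rfl (by omega))
    rw [ih x (by omega) (by omega), zero_mul]

theorem isUnit_of_X_pow_mem_span (h0 : p.coeff 0 ≠ 0) (h : X ^ k ∈ Ideal.span {p}) :
    IsUnit p := by
  obtain ⟨q, hq⟩ := Ideal.mem_span_singleton'.1 h
  rw [← monomial_one_right_eq_X_pow] at hq
  have hdeg : degree q + degree p = k := by rw [← degree_mul, hq, degree_monomial one_ne_zero]
  have hne : q * p ≠ 0 := hq ▸ ne_zero_of_degree_eq (degree_monomial one_ne_zero)
  obtain ⟨l, hl⟩ := exists_degree_eq (left_ne_zero_of_mul hne)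
  obtain ⟨j, hj⟩ := exists_degree_eq (right_ne_zero_of_mul hne)
  have hkl : k ≤ l := by
    by_contra! hlk
    refine (degree_eq_iff.1 hl).2 (coeff_eq_zero_of_coeff_mul_eq_zero h0 (fun i hi => ?_) hlk)
    rw [hq, coeff_monomial, if_neg hi.ne']
  rw [hl, hj, ← Nat.cast_add, Nat.cast_inj] at hdeg
  rw [isUnit_iff_degree_eq_zero, hj, Nat.cast_eq_zero]
  omega

end LinearFactor

section SkewNorm

variable {D : Type*} [DivisionRing D]

/-- The norm `σ ^ (k - 1) (b) ⋯ σ(b) b`, for which `t ^ k` is congruent to the norm of `b` modulo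
`R (t - b)`. -/
def skewNorm (σ : D ≃+* D) (k : ℕ) (b : D) : D :=
  ((List.range' 1 k).map fun j => σ^[k - j] b).prod

theorem map_list_prod_iterate (σ : D ≃+* D) (b : D) (k : ℕ) (l : List ℕ) (hl : ∀ j ∈ l, j ≤ k) :
    σ (l.map fun j => σ^[k - j] b).prod = (l.map fun j => σ^[k + 1 - j] b).prod := by
  rw [map_list_prod, List.map_map]
  refine congrArg _ (List.map_congr_left fun j hj => ?_)
  rw [Function.comp_apply, Nat.sub_add_comm (hl j hj), Function.iterate_succ_apply']

theorem skewNorm_succ (σ : D ≃+* D) (k : ℕ) (b : D) :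
    skewNorm σ (k + 1) b = σ (skewNorm σ k b) * b := by
  rw [skewNorm, List.range'_1_concat, List.map_append, List.prod_append, skewNorm,
    map_list_prod_iterate]
  · simp only [List.map_singleton, List.prod_singleton, add_comm 1 k, Nat.sub_self,
      Function.iterate_zero_apply]
  · intro j hj
    rw [List.mem_range'_1] at hj
    omega

theorem map_skewNorm (σ : D ≃+* D) (k : ℕ) (b : D) :
    σ (skewNorm σ k b) = ((List.range k).map fun j => σ^[k - j] b).prod := by
  rw [skewNorm, map_list_prod_iterate, List.range'_eq_map_range, List.map_map]
  · refine congrArg _ (List.map_congr_left fun j _ => ?_)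
    rw [Function.comp_apply, Nat.add_comm 1 j, Nat.add_sub_add_right]
  · intro j hj
    rw [List.mem_range'_1] at hj
    omega

theorem Omega_mul_inv_Omega (σ : D ≃+* D) (c c' : Dˣ) (b : D) :
    Omega σ (c * c'⁻¹) (Omega σ c' b) = Omega σ c b := by
  have hσc : σ (c' : D) ≠ 0 := (map_ne_zero_iff _ σ.injective).2 c'.ne_zero
  simp only [Omega, Units.val_mul, Units.val_inv_eq_inv_val, map_mul, map_inv₀, mul_inv_rev,
    inv_inv, mul_assoc, inv_mul_cancel_left₀ c'.ne_zero, inv_mul_cancel_left₀ hσc]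

variable {σ : D ≃+* D} {u : Dˣ} {n : ℕ} {a b : D}

theorem mul_eq_skewNorm_iff (hu : σ u = u) (ha : σ a = a) :
    u * a = skewNorm σ n b ↔
      ((u⁻¹ : Dˣ) : D) * ((List.range n).map fun j => σ^[n - j] b).prod = a := by
  have hua : σ (u * a) = u * a := by rw [map_mul, hu, ha]
  rw [← map_skewNorm, Units.inv_mul_eq_iff_eq_mul, ← hua, σ.injective.eq_iff, hua, eq_comm]

theorem ne_zero_of_skewNorm_ne_zero (hn : n ≠ 0) (h : skewNorm σ n b ≠ 0) : b ≠ 0 := by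
  obtain ⟨k, rfl⟩ := Nat.exists_eq_succ_of_ne_zero hn
  rw [Nat.succ_eq_add_one, skewNorm_succ] at h
  exact right_ne_zero_of_mul h

end SkewNorm

section LinearFactorNorm

variable {D : Type*} [DivisionRing D] [MulSemiringAction (Multiplicative ℕ) D]
  {σ : D ≃+* D} {h f : SkewPolynomial D} {b : D}

theorem X_pow_sub_skewNorm_mem_span (hσ : ∀ x : D, φ x = σ x) (b : D) (k : ℕ) :
    X ^ k - C (skewNorm σ k b) ∈ Ideal.span {X - C b} := by
  induction k with
  | zero => simp [skewNorm, C_1]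
  | succ k ih =>
    have hsucc : X ^ (k + 1) - C (skewNorm σ (k + 1) b) =
        X * (X ^ k - C (skewNorm σ k b)) + C (σ (skewNorm σ k b)) * (X - C b) := by
      rw [skewNorm_succ, mul_sub, mul_sub, X_mul_C, hσ, C_mul, pow_succ']
      abel
    rw [hsucc]
    exact Ideal.add_mem _ (Ideal.mul_mem_left _ _ ih)
      (Ideal.mul_mem_left _ _ (Ideal.mem_span_singleton_self _))

theorem X_pow_sub_C_mem_span_iff (hσ : ∀ x : D, φ x = σ x) {k : ℕ} {x : D} :
    X ^ k - C x ∈ Ideal.span {X - C b} ↔ x = skewNorm σ k b := by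
  have hN := X_pow_sub_skewNorm_mem_span hσ b k
  refine ⟨fun h => ?_, fun h => h ▸ hN⟩
  have hmem := Ideal.sub_mem _ hN h
  rw [sub_sub_sub_cancel_left, ← C_sub] at hmem
  by_contra hne
  have hC := isUnit_C (sub_ne_zero.2 hne)
  refine hC.ne_zero (eq_zero_of_mem_span_of_degree_lt hmem ?_)
  rw [isUnit_iff_degree_eq_zero.1 hC, (isMonicOfDegree_X_sub_C b).1]
  exact zero_lt_one

theorem X_sub_C_Omega_mul_C (hσ : ∀ x : D, φ x = σ x) (c : Dˣ) (b : D) :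
    (X - C (Omega σ c b)) * C (c : D) = C (σ c) * (X - C b) := by
  rw [sub_mul, mul_sub, X_mul_C, hσ, ← C_mul, ← C_mul, Omega, mul_assoc _ _ (c : D),
    Units.inv_mul, mul_one]

theorem mul_C_mem_span_X_sub_C_iff (hσ : ∀ x : D, φ x = σ x) (c : Dˣ) :
    f * C (c : D) ∈ Ideal.span {X - C b} ↔ f ∈ Ideal.span {X - C (Omega σ c b)} := by
  have hσc : σ (c : D) ≠ 0 := (map_ne_zero_iff _ σ.injective).2 c.ne_zero
  rw [← Ideal.span_singleton_mul_left_unit (isUnit_C hσc), ← X_sub_C_Omega_mul_C hσ]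
  simp only [Ideal.mem_span_singleton', ← mul_assoc, (isUnit_C c.ne_zero).mul_left_inj]

theorem mem_span_X_sub_C_Omega (hσ : ∀ x : D, φ x = σ x)
    (hh : h ∈ Subring.center (SkewPolynomial D)) (c : Dˣ)
    (hb : h ∈ Ideal.span {X - C b}) : h ∈ Ideal.span {X - C (Omega σ c b)} := by
  rw [← mul_C_mem_span_X_sub_C_iff hσ, ← Subring.mem_center_iff.1 hh]
  exact Ideal.mul_mem_left _ _ hb

end LinearFactorNorm

namespace IsCentralMaximal

variable {D : Type*} [DivisionRing D] [MulSemiringAction (Multiplicative ℕ) D]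
  {h p q f : SkewPolynomial D} {k n m e : ℕ} {b : D}

theorem exists_mem_span_degree_le (hh : IsCentralMaximal h) (h0 : h ≠ 0)
    (hp : h ∈ Ideal.span {p}) (hp1 : ¬ IsUnit p) (hq : h ∈ Ideal.span {q}) (hq1 : ¬ IsUnit q) :
    ∃ l s, IsMonicOfDegree s l ∧ 0 < l ∧ l ≤ degree p ∧ q ∈ Ideal.span {s} := by
  obtain ⟨w, hw, hqw⟩ := hh.exists_notMem_mul_mem h0 hp (mt span_singleton_eq_top_iff.1 hp1) hq hq1
  let J := Submodule.comap (LinearMap.toSpanSingleton (SkewPolynomial D) (SkewPolynomial D) w)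
    (Ideal.span {p})
  have hqJ : q ∈ J := hqw
  have hp0 : p ≠ 0 := by rintro rfl; exact h0 (by simpa using hp)
  have hq0 : q ≠ 0 := by rintro rfl; exact h0 (by simpa using hq)
  obtain ⟨l, s, hs, hJ⟩ := exists_isMonicOfDegree_span_eq ((Submodule.ne_bot_iff J).2 ⟨q, hqJ, hq0⟩)
  obtain ⟨r, hr0, hrp, hr⟩ := exists_mul_mem_span hp0 w
  have hrJ : r ∈ J := hr
  rw [hJ] at hqJ hrJ
  refine ⟨l, s, hs, Nat.pos_of_ne_zero ?_, ?_, hqJ⟩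
  · rintro rfl
    have h1 : 1 ∈ J := by rw [hJ, isMonicOfDegree_zero_iff.1 hs]; exact Ideal.subset_span rfl
    exact hw (by simpa [J] using h1)
  · rw [← hs.1]
    exact (degree_le_degree_of_mem_span hrJ hr0).trans hrp

/-- The composition factors of `R ⧸ R q` all have the least possible dimension over `D`. -/
theorem dvd_degree_of_forall_le (hh : IsCentralMaximal h) (h0 : h ≠ 0)
    (hp : h ∈ Ideal.span {p}) (hpe : degree p = e) (he : 0 < e)
    (hmin : ∀ l s, IsMonicOfDegree s l → h ∈ Ideal.span {s} → 0 < l → e ≤ l)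
    (hq : h ∈ Ideal.span {q}) (hqk : degree q = k) : e ∣ k := by
  induction k using Nat.strong_induction_on generalizing q with | _ k ih => ?_
  rcases k.eq_zero_or_pos with rfl | hk
  · exact dvd_zero e
  obtain ⟨l, s, hs, hl, hle, hqs⟩ :=
    hh.exists_mem_span_degree_le h0 hp (not_isUnit_of_degree_eq hpe he) hq
      (not_isUnit_of_degree_eq hqk hk)
  rw [hpe, Nat.cast_le] at hle
  have hhs : h ∈ Ideal.span {s} := (Ideal.span_singleton_le_iff_mem _).2 hqs hq
  obtain rfl : l = e := hle.antisymm (hmin l s hs hhs hl)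
  obtain ⟨r, rfl⟩ := Ideal.mem_span_singleton'.1 hqs
  obtain ⟨j, hj⟩ := exists_degree_eq (left_ne_zero_of_mul (ne_zero_of_degree_eq hqk))
  rw [degree_mul, hj, hs.1, ← Nat.cast_add, Nat.cast_inj] at hqk
  rw [← hqk]
  exact dvd_add (ih j (by omega) (mem_span_of_mem_span_mul hh.mem_center hq) hj) dvd_rfl

theorem exists_mem_span_X_sub_C (hh : IsCentralMaximal h) (hn : n.Prime) (hdeg : degree h = n)
    (hq : h ∈ Ideal.span {q}) (hqk : IsMonicOfDegree q k) (hk : 0 < k) (hkn : k < n) :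
    ∃ b, h ∈ Ideal.span {X - C b} := by
  classical
  have hex : ∃ l, 0 < l ∧ ∃ s, IsMonicOfDegree s l ∧ h ∈ Ideal.span {s} := ⟨k, hk, q, hqk, hq⟩
  obtain ⟨he, p, hpe, hp⟩ := Nat.find_spec hex
  have hen : Nat.find hex ∣ n :=
    hh.dvd_degree_of_forall_le (ne_zero_of_degree_eq hdeg) hp hpe.1 he
      (fun l s hs hhs hl => Nat.find_min' hex ⟨hl, s, hs, hhs⟩)
      (Ideal.mem_span_singleton_self h) hdeg
  have he1 : Nat.find hex = 1 := ((Nat.dvd_prime hn).1 hen).resolve_right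
    ((Nat.find_min' hex ⟨hk, q, hqk, hq⟩).trans_lt hkn).ne
  rw [he1] at hpe
  exact ⟨_, hpe.eq_X_sub_C ▸ hp⟩

theorem exists_mem_span_X_sub_C_Omega {σ : D ≃+* D} (hσ : ∀ x : D, φ x = σ x)
    (hh : IsCentralMaximal h) (h0 : h ≠ 0) (hb : h ∈ Ideal.span {X - C b})
    (hf : h ∈ Ideal.span {f}) (hf1 : ¬ IsUnit f) :
    ∃ c : Dˣ, f ∈ Ideal.span {X - C (Omega σ c b)} := by
  have hXb := not_isUnit_of_degree_eq (isMonicOfDegree_X_sub_C b).1 one_pos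
  obtain ⟨w, hw, hfw⟩ := hh.exists_notMem_mul_mem h0 hb (mt span_singleton_eq_top_iff.1 hXb) hf hf1
  obtain ⟨c, hc⟩ := exists_sub_C_mem_span b w
  have hc0 : c ≠ 0 := by
    rintro rfl
    exact hw (by rwa [C_0, sub_zero] at hc)
  refine ⟨.mk0 c hc0, (mul_C_mem_span_X_sub_C_iff hσ _).1 ?_⟩
  rw [Units.val_mk0, ← sub_sub_cancel w (C c), mul_sub]
  exact Ideal.sub_mem _ hfw (Ideal.mul_mem_left _ f hc)

theorem exists_eq_prod_X_sub_C_Omega {σ : D ≃+* D} (hσ : ∀ x : D, φ x = σ x)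
    (hh : IsCentralMaximal h) (h0 : h ≠ 0) (hb : h ∈ Ideal.span {X - C b})
    (hf : h ∈ Ideal.span {f}) (hfm : IsMonicOfDegree f m) :
    ∃ c : ℕ → Dˣ, f = ((List.range' 1 m).map fun i => X - C (Omega σ (c i) b)).prod := by
  induction m generalizing f with
  | zero => exact ⟨fun _ => 1, isMonicOfDegree_zero_iff.1 hfm⟩
  | succ m ih =>
    have hf1 := not_isUnit_of_degree_eq hfm.1 m.succ_pos
    obtain ⟨c, hc⟩ := hh.exists_mem_span_X_sub_C_Omega hσ h0 hb hf hf1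
    obtain ⟨g, rfl⟩ := Ideal.mem_span_singleton'.1 hc
    have hg : IsMonicOfDegree g m := hfm.of_mul_right (isMonicOfDegree_X_sub_C _)
    obtain ⟨c', hc'⟩ := ih (mem_span_of_mem_span_mul hh.mem_center hf) hg
    have hupdate : ∀ i ∈ List.range' 1 m, Function.update c' (1 + m) c i = c' i := fun i hi =>
      Function.update_of_ne (by rw [List.mem_range'_1] at hi; omega) _ _
    refine ⟨Function.update c' (1 + m) c, ?_⟩
    rw [List.range'_1_concat, List.map_append, List.prod_append, List.map_singleton,
      List.prod_singleton, Function.update_self, hc']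
    exact congrArg (· * _) <| congrArg _ <|
      List.map_congr_left fun i hi => by rw [hupdate i hi]

end IsCentralMaximal

section InnerTwist

variable {D : Type*} [DivisionRing D] [MulSemiringAction (Multiplicative ℕ) D]
  {σ : D ≃+* D} {u : Dˣ} {n k i : ℕ} {a c : D} {q r : SkewPolynomial D}

/-- `σ` is the twist of `D[t;σ]` and has inner order `n`, and `σ ^ n` is the conjugation by the
`σ`-fixed unit `u`. -/
structure IsInnerTwist (σ : D ≃+* D) (u : Dˣ) (n : ℕ) : Prop where
  twist : ∀ x : D, φ x = σ x
  iterate_eq : ∀ x : D, σ^[n] x = u * x * (u⁻¹ : Dˣ)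
  not_isInner : ∀ i : ℕ, 1 ≤ i → i < n → ¬ IsInner (σ^[i])
  fixed : σ u = u

/-- The generator `u⁻¹ t ^ n` of the centre of `D[t;σ]` over `F`. -/
noncomputable def centralVar (u : Dˣ) (n : ℕ) : SkewPolynomial D :=
  C ((u⁻¹ : Dˣ) : D) * X ^ n

/-- The value `u⁻¹ t ^ n - a` of the linear polynomial `x - a` at `u⁻¹ t ^ n`. -/
noncomputable def centralBinomial (u : Dˣ) (n : ℕ) (a : D) : SkewPolynomial D :=
  centralVar u n - C a

/-- `a` lies in the image of `F = C ∩ Fix(σ)` in `D`. -/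
def IsFixedCentral (σ : D ≃+* D) (a : D) : Prop :=
  a ∈ Subring.center D ∧ σ a = a

theorem phi_iterate (hσ : ∀ x : D, φ x = σ x) (k : ℕ) : φ^[k] = σ^[k] :=
  congrArg (·^[k]) (funext hσ)

theorem mem_center_iff_forall_C_X :
    r ∈ Subring.center (SkewPolynomial D) ↔ (∀ y, C y * r = r * C y) ∧ X * r = r * X := by
  refine ⟨fun h => ⟨fun y => Subring.mem_center_iff.1 h _, Subring.mem_center_iff.1 h _⟩,
    fun ⟨hC, hX⟩ => Subring.mem_center_iff.2 fun p => ?_⟩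
  induction p using SkewPolynomial.induction with
  | h0 => rw [zero_mul, mul_zero]
  | ha k y q _ _ ih =>
    have hyk : Commute (C y * X ^ k) r := .mul_left (hC y) (.pow_left hX k)
    rw [add_mul, mul_add, ih, ← C_mul_X_pow_eq_monomial, hyk.eq]

theorem C_mul_centralBinomial (u : Dˣ) (n : ℕ) (a : D) :
    C (u : D) * centralBinomial u n a = X ^ n - C (u * a) := by
  rw [centralBinomial, centralVar, mul_sub, ← mul_assoc, ← C_mul, ← C_mul, Units.mul_inv, C_1,
    one_mul]

theorem span_centralBinomial (u : Dˣ) (n : ℕ) (a : D) :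
    Ideal.span {centralBinomial u n a} = Ideal.span {X ^ n - C (u * a)} := by
  rw [← C_mul_centralBinomial, Ideal.span_singleton_mul_left_unit (isUnit_C u.ne_zero)]

theorem degree_centralBinomial (u : Dˣ) (hn : 0 < n) (a : D) :
    degree (centralBinomial u n a) = n := by
  rw [← (isMonicOfDegree_X_pow_sub_C hn (u * a)).1, ← C_mul_centralBinomial, degree_mul,
    isUnit_iff_degree_eq_zero.1 (isUnit_C u.ne_zero), zero_add]

theorem centralVar_mem_center (hσ : ∀ x : D, φ x = σ x)
    (hn : ∀ x : D, σ^[n] x = u * x * (u⁻¹ : Dˣ)) (hu : σ u = u) :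
    centralVar u n ∈ Subring.center (SkewPolynomial D) := by
  refine mem_center_iff_forall_C_X.2 ⟨fun y => ?_, ?_⟩
  · rw [centralVar, mul_assoc, X_pow_mul_C, ← mul_assoc, ← C_mul, ← mul_assoc, ← C_mul,
      phi_iterate hσ, hn, mul_assoc, Units.inv_mul_cancel_left]
  · rw [centralVar, ← mul_assoc, X_mul_C, hσ, Units.val_inv_eq_inv_val, map_inv₀, hu, mul_assoc,
      mul_assoc, ← pow_succ', ← pow_succ]

theorem C_mem_center (hσ : ∀ x : D, φ x = σ x) (ha : IsFixedCentral σ a) :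
    C a ∈ Subring.center (SkewPolynomial D) := by
  refine mem_center_iff_forall_C_X.2 ⟨fun y => ?_, ?_⟩
  · rw [← C_mul, ← C_mul, Subring.mem_center_iff.1 ha.1]
  · rw [X_mul_C, hσ, ha.2]

namespace IsInnerTwist

theorem centralBinomial_mem_center (H : IsInnerTwist σ u n) (ha : IsFixedCentral σ a) :
    centralBinomial u n a ∈ Subring.center (SkewPolynomial D) :=
  sub_mem (centralVar_mem_center H.twist H.iterate_eq H.fixed) (C_mem_center H.twist ha)

theorem eq_zero_of_intertwines (H : IsInnerTwist σ u n) (hik : i ≠ k) (hi : i < n) (hk : k < n)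
    (hc : ∀ y, c * σ^[i] y = σ^[k] y * c) : c = 0 := by
  by_contra hc0
  wlog hlt : i < k generalizing i k c
  · refine this hik.symm hk hi (c := c⁻¹) (fun y => ?_) (inv_ne_zero hc0) (by omega)
    rw [inv_mul_eq_iff_eq_mul₀ hc0, ← mul_assoc, hc, mul_inv_cancel_right₀ hc0]
  refine H.not_isInner (k - i) (by omega) (by omega) ⟨Units.mk0 c hc0, fun x => ?_⟩
  obtain ⟨y, rfl⟩ := σ.surjective.iterate i x
  rw [← Function.iterate_add_apply, Nat.sub_add_cancel hlt.le, Units.val_mk0, hc y,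
    Units.val_inv_eq_inv_val, Units.val_mk0, mul_inv_cancel_right₀ hc0]

theorem coeff_eq_zero_of_mul_C_eq (H : IsInnerTwist σ u n) (hk : k < n)
    (hr : ∀ y, r * C y = C (σ^[k] y) * r) (hi : i < n) (hik : i ≠ k) : r.coeff i = 0 := by
  refine H.eq_zero_of_intertwines hik hi hk fun y => ?_
  simpa only [coeff_mul_C, coeff_C_mul, phi_iterate H.twist] using congrArg (coeff · i) (hr y)

theorem eq_X_pow_of_isTwoSided_span (H : IsInnerTwist σ u n) (hq : IsMonicOfDegree q k)
    (hk : k < n) [(Ideal.span {q}).IsTwoSided] : q = X ^ k := by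
  have hqspan := Ideal.mem_span_singleton_self q
  have hcomm (y : D) : q * C y = C (σ^[k] y) * q := by
    refine sub_eq_zero.1 <| eq_zero_of_mem_span_of_degree_lt (Ideal.sub_mem _
      (Ideal.mul_mem_right (C y) _ hqspan) (Ideal.mul_mem_left _ (C (σ^[k] y)) hqspan)) ?_
    rw [hq.1, degree_lt_iff]
    intro i hi
    rw [coeff_sub, coeff_mul_C, coeff_C_mul, phi_iterate H.twist]
    rcases hi.eq_or_lt with rfl | hi
    · rw [hq.2, one_mul, mul_one, sub_self]
    · rw [degree_le_iff.1 hq.1.le i hi, zero_mul, mul_zero, sub_zero]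
  ext i
  rw [← monomial_one_right_eq_X_pow, coeff_monomial]
  split_ifs with hki
  · rw [← hki, hq.2]
  · rcases lt_or_ge k i with hi | hi
    · exact degree_le_iff.1 hq.1.le i hi
    · exact H.coeff_eq_zero_of_mul_C_eq hk hcomm (hi.trans_lt hk) (Ne.symm hki)

theorem isCentralMaximal_centralBinomial (H : IsInnerTwist σ u n) (hn : 0 < n)
    (ha : IsFixedCentral σ a) (ha0 : a ≠ 0) : IsCentralMaximal (centralBinomial u n a) where
  mem_center := H.centralBinomial_mem_center ha
  span_ne_top := mt span_singleton_eq_top_iff.1 <|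
    not_isUnit_of_degree_eq (degree_centralBinomial u hn a) hn
  eq_or_eq_top I _ hI := by
    have hbinom := isMonicOfDegree_X_pow_sub_C hn (u * a)
    rw [span_centralBinomial]
    rw [← Ideal.span_singleton_le_iff_mem, span_centralBinomial, Ideal.span_singleton_le_iff_mem]
      at hI
    obtain ⟨k, q, hq, rfl⟩ := exists_isMonicOfDegree_span_eq
      ((Submodule.ne_bot_iff I).2 ⟨_, hI, hbinom.ne_zero⟩)
    have hkn : k ≤ n := by
      simpa only [hq.1, hbinom.1, Nat.cast_le] using
        degree_le_degree_of_mem_span hI hbinom.ne_zero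
    rcases hkn.eq_or_lt with rfl | hkn
    · exact .inl (by rw [hbinom.eq_of_mem_span hq hI])
    · have hXn : X ^ n ∈ Ideal.span {q} := by
        rw [H.eq_X_pow_of_isTwoSided_span hq hkn, ← Nat.sub_add_cancel hkn.le, pow_add]
        exact Ideal.mul_mem_left _ _ (Ideal.mem_span_singleton_self _)
      have hua := Ideal.sub_mem _ hXn hI
      rw [sub_sub_cancel] at hua
      exact .inr (Ideal.eq_top_of_isUnit_mem _ hua (isUnit_C (mul_ne_zero u.ne_zero ha0)))

theorem eq_C_of_forall_mul_sub_mul_mem (H : IsInnerTwist σ u n) (hn : 0 < n)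
    (hr : ∀ y, r * C y - C y * r ∈ Ideal.span {centralBinomial u n a}) (hdeg : degree r < n) :
    r = C (r.coeff 0) ∧ r.coeff 0 ∈ Subring.center D := by
  have hcomm (y : D) : r * C y = C y * r := by
    refine sub_eq_zero.1 (eq_zero_of_mem_span_of_degree_lt (hr y) ?_)
    rw [degree_centralBinomial u hn, degree_lt_iff]
    intro i hi
    rw [coeff_sub, coeff_mul_C, coeff_C_mul, degree_lt_iff.1 hdeg i hi, zero_mul, mul_zero,
      sub_zero]
  refine ⟨eq_C_of_degree_le_zero (degree_le_iff.2 fun i hi => ?_),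
    Subring.mem_center_iff.2 fun y => ?_⟩
  · rcases lt_or_ge i n with hin | hin
    · exact H.coeff_eq_zero_of_mul_C_eq hn hcomm hin hi.ne'
    · exact degree_lt_iff.1 hdeg i hin
  · simpa only [coeff_mul_C, coeff_C_mul, Function.iterate_zero, id_eq] using
      congrArg (coeff · 0) (hcomm y).symm

theorem map_eq_of_C_mul_X_sub_X_mul_C_mem (H : IsInnerTwist σ u n) (hn : 0 < n) (ha0 : a ≠ 0)
    (hc : C c * X - X * C c ∈ Ideal.span {centralBinomial u n a}) : σ c = c := by
  by_contra hne
  rw [X_mul_C, H.twist, ← sub_mul, ← C_sub, span_centralBinomial] at hc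
  have hX := (Submodule.smul_mem_iff_of_isUnit _ (isUnit_C (sub_ne_zero.2 (Ne.symm hne)))).1 hc
  have h0 : (X ^ n - C (u * a) : SkewPolynomial D).coeff 0 ≠ 0 := by
    rw [← monomial_one_right_eq_X_pow, coeff_sub, coeff_monomial, if_neg hn.ne', coeff_C_zero,
      zero_sub, neg_ne_zero]
    exact mul_ne_zero u.ne_zero ha0
  exact not_isUnit_of_degree_eq (isMonicOfDegree_X_pow_sub_C hn _).1 hn
    (isUnit_of_X_pow_mem_span (k := 1) h0 (by rwa [pow_one]))

theorem exists_sub_C_mem_span_centralBinomial (H : IsInnerTwist σ u n) (hn : 0 < n)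
    (ha : IsFixedCentral σ a) (ha0 : a ≠ 0)
    (hr : ∀ p, r * p - p * r ∈ Ideal.span {centralBinomial u n a}) :
    ∃ c, IsFixedCentral σ c ∧ r - C c ∈ Ideal.span {centralBinomial u n a} := by
  have htwo := isTwoSided_span_singleton (H.centralBinomial_mem_center ha)
  have hdeg := degree_centralBinomial u hn a
  obtain ⟨s, hs⟩ := exists_degree_sub_mul_lt (ne_zero_of_degree_eq hdeg) r
  have hsh : s * centralBinomial u n a ∈ Ideal.span {centralBinomial u n a} :=
    Ideal.mem_span_singleton'.2 ⟨s, rfl⟩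
  generalize hr' : r - s * centralBinomial u n a = r' at hs
  obtain rfl : r = r' + s * centralBinomial u n a := by rw [← hr', sub_add_cancel]
  have hcomm (p : SkewPolynomial D) : r' * p - p * r' ∈ Ideal.span {centralBinomial u n a} := by
    have h := Ideal.sub_mem _ (hr p)
      (Ideal.sub_mem _ (Ideal.mul_mem_right p _ hsh) (Ideal.mul_mem_left _ p hsh))
    rwa [add_mul, mul_add, add_sub_add_comm, add_sub_cancel_right] at h
  obtain ⟨hC, hcenter⟩ := H.eq_C_of_forall_mul_sub_mul_mem hn (fun y => hcomm (C y)) (hdeg ▸ hs)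
  have hX := hcomm X
  rw [hC] at hX
  refine ⟨_, ⟨hcenter, H.map_eq_of_C_mul_X_sub_X_mul_C_mem hn ha0 hX⟩, ?_⟩
  rwa [← hC, add_sub_cancel_left]

end IsInnerTwist

end InnerTwist

section Quotient

variable {K D : Type*} [Field K] [DivisionRing D] [Algebra K D] [FiniteDimensional K D]
  [MulSemiringAction (Multiplicative ℕ) D] [SMulCommClass (Multiplicative ℕ) K D]
  {σ : D ≃+* D} {u : Dˣ} {n : ℕ} {a : D}

theorem finiteDimensional_quotient {h : SkewPolynomial D} (hdeg : degree h = n)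
    [(Ideal.span {h}).IsTwoSided] : FiniteDimensional K (SkewPolynomial D ⧸ Ideal.span {h}) := by
  let ψ : (Fin n → D) →ₗ[K] SkewPolynomial D := LinearMap.lsum K (fun _ => D) K fun i =>
    SkewMonoidAlgebra.lsingle K (Multiplicative.ofAdd (i : ℕ))
  have hψ (r : SkewPolynomial D) (hr : degree r < n) : ψ (fun i => r.coeff i) = r := by
    have hsupp : r.support ⊆ Finset.range n := fun i hi => Finset.mem_range.2 <| by
      by_contra hni
      exact mem_support_iff.1 hi (degree_lt_iff.1 hr i (not_lt.1 hni))
    calc ψ (fun i => r.coeff i) = ∑ i : Fin n, monomial (i : ℕ) (r.coeff i) := by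
          simp only [ψ, LinearMap.lsum_apply, LinearMap.sum_apply]
          rfl
      _ = ∑ i ∈ Finset.range n, monomial i (r.coeff i) :=
          Fin.sum_univ_eq_sum_range (fun i => monomial i (r.coeff i)) n
      _ = r := by
          rw [← sum_eq_of_subset (fun i c => monomial i c) (fun i => monomial_zero_right i) hsupp,
            sum_monomial]
  refine .of_surjective ((Ideal.Quotient.mkₐ K (Ideal.span {h})).toLinearMap ∘ₗ ψ) fun c => ?_
  obtain ⟨g, rfl⟩ := Ideal.Quotient.mk_surjective c
  obtain ⟨s, hs⟩ := exists_degree_sub_mul_lt (ne_zero_of_degree_eq hdeg) g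
  refine ⟨_, (congrArg (Ideal.Quotient.mk _) (hψ _ (hdeg ▸ hs))).trans (Ideal.Quotient.eq.2 ?_)⟩
  rw [sub_sub_cancel_left, neg_mem_iff]
  exact Ideal.mem_span_singleton'.2 ⟨s, rfl⟩

theorem IsInnerTwist.isCentralSimpleAlgebra_quotient (H : IsInnerTwist σ u n) (hn : 0 < n)
    (hK : ∀ x : D, IsFixedCentral σ x → ∃ k : K, algebraMap K D k = x)
    (ha : IsFixedCentral σ a) (ha0 : a ≠ 0) [(Ideal.span {centralBinomial u n a}).IsTwoSided] :
    IsCentralSimpleAlgebra K (SkewPolynomial D ⧸ Ideal.span {centralBinomial u n a}) where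
  central := ⟨fun c hc => by
    obtain ⟨r, rfl⟩ := Ideal.Quotient.mk_surjective c
    have hr (p : SkewPolynomial D) : r * p - p * r ∈ Ideal.span {centralBinomial u n a} :=
      Ideal.Quotient.eq.1 (Subalgebra.mem_center_iff.1 hc (Ideal.Quotient.mk _ p)).symm
    obtain ⟨x, hx, hrx⟩ := H.exists_sub_C_mem_span_centralBinomial hn ha ha0 hr
    obtain ⟨k, rfl⟩ := hK x hx
    exact Algebra.mem_bot.2 ⟨k, (Ideal.Quotient.eq.2 hrx).symm⟩⟩
  simple := (H.isCentralMaximal_centralBinomial hn ha ha0).isSimpleRing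
  finite := finiteDimensional_quotient (degree_centralBinomial u hn a)

end Quotient

section FixedField

variable {C D : Type*} [Field C] [DivisionRing D] [Algebra C D]

section Twist

variable [MulSemiringAction (Multiplicative ℕ) D] {σ : D ≃+* D}

theorem mem_fixedField_iff (hσ : ∀ x : D, φ x = σ x) {c : C} :
    c ∈ fixedField C D ↔ σ (algebraMap C D c) = algebraMap C D c := by
  rw [← hσ]
  rfl

theorem isFixedCentral_algebraMap (hσ : ∀ x : D, φ x = σ x) (k : fixedField C D) :
    IsFixedCentral σ (algebraMap (fixedField C D) D k) :=
  ⟨Subring.mem_center_iff.2 fun x => (Algebra.commutes k x).symm, (mem_fixedField_iff hσ).1 k.2⟩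

end Twist

variable [Algebra.IsCentral C D]

theorem exists_algebraMap_eq {x : D} (hx : x ∈ Subring.center D) :
    ∃ c : C, algebraMap C D c = x := by
  obtain ⟨c, hc⟩ := (Algebra.IsCentral.mem_center_iff C).1
    (Subalgebra.mem_center_iff.2 (Subring.mem_center_iff.1 hx))
  exact ⟨c, hc.symm⟩

theorem exists_ringEquiv_algebraMap_eq (σ : D ≃+* D) :
    ∃ τ : C ≃+* C, ∀ c, algebraMap C D (τ c) = σ (algebraMap C D c) := by
  have hmem (c : C) : algebraMap C D c ∈ Subring.center D :=
    Subring.mem_center_iff.2 fun x => (Algebra.commutes c x).symm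
  let e : C ≃+* Subring.center D := .ofBijective ((algebraMap C D).codRestrict _ hmem)
    ⟨RingHom.injective _, fun x => (exists_algebraMap_eq x.2).imp fun _ => Subtype.ext⟩
  refine ⟨(e.trans (Subring.centerCongr σ)).trans e.symm, fun c => ?_⟩
  exact congrArg Subtype.val (e.apply_symm_apply (Subring.centerCongr σ (e c)))

variable [MulSemiringAction (Multiplicative ℕ) D] {σ : D ≃+* D} {u : Dˣ} {n : ℕ}

theorem exists_algebraMap_fixedField_eq (hσ : ∀ x : D, φ x = σ x) {x : D}
    (hx : IsFixedCentral σ x) : ∃ k : fixedField C D, algebraMap (fixedField C D) D k = x := by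
  obtain ⟨c, rfl⟩ := exists_algebraMap_eq (C := C) hx.1
  exact ⟨⟨c, (mem_fixedField_iff hσ).2 hx.2⟩, rfl⟩

/- Since `σ ^ n` is inner, `σ` restricts to an automorphism of `C` of finite order, and Artin's
theorem applies. -/
theorem finiteDimensional_fixedField (hσ : ∀ x : D, φ x = σ x) (hn : 0 < n)
    (hu : ∀ x : D, σ^[n] x = u * x * (u⁻¹ : Dˣ)) : FiniteDimensional (fixedField C D) C := by
  obtain ⟨τ, hτ⟩ := exists_ringEquiv_algebraMap_eq (C := C) σ
  have hinj := (algebraMap C D).injective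
  have hpow : τ ^ n = 1 := RingEquiv.ext fun c => hinj <| by
    have hiter : Function.Semiconj (algebraMap C D) τ^[n] σ^[n] :=
      Function.Semiconj.iterate_right hτ n
    rw [RingAut.coe_pow, hiter.eq, hu, ← Algebra.commutes, Units.mul_inv_cancel_right,
      RingAut.one_apply]
  have hfin : Finite (Subgroup.zpowers τ) :=
    (isOfFinOrder_iff_pow_eq_one.2 ⟨n, hn, hpow⟩).finite_zpowers
  have hfixed : fixedField C D = FixedPoints.subfield (Subgroup.zpowers τ) C := by
    ext c
    rw [mem_fixedField_iff hσ, ← hτ, hinj.eq_iff]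
    refine ⟨fun h => ?_, fun h => h ⟨τ, Subgroup.mem_zpowers τ⟩⟩
    have hle : Subgroup.zpowers τ ≤ MulAction.stabilizer (C ≃+* C) c :=
      Subgroup.zpowers_le.2 h
    exact fun g => hle g.2
  rw [hfixed]
  infer_instance

end FixedField

section GeneralisedAPolynomial

variable {C D : Type*} [Field C] [DivisionRing D] [Algebra C D]
  [MulSemiringAction (Multiplicative ℕ) D] {σ : D ≃+* D} {u : Dˣ} {n : ℕ} {f : SkewPolynomial D}

theorem IsGeneralisedAPolynomial.exists_sub_algebraMap_mem_span
    (hf : IsGeneralisedAPolynomial C f) {z : SkewPolynomial D}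
    (hz : z ∈ Subring.center (SkewPolynomial D)) :
    ∃ a : fixedField C D,
      z - SkewPolynomial.C (algebraMap (fixedField C D) D a) ∈ Ideal.span {f} := by
  have hzf : z ∈ idealiser (fixedField C D) f := by
    change f * z ∈ Ideal.span {f}
    rw [Subring.mem_center_iff.1 hz]
    exact Ideal.mul_mem_left _ z (Ideal.mem_span_singleton_self f)
  have hcenter : Ideal.Quotient.mk (eigenIdeal (fixedField C D) f) ⟨z, hzf⟩ ∈
      Subalgebra.center (fixedField C D) (Eigenring (fixedField C D) f) := by
    refine Subalgebra.mem_center_iff.2 fun c => ?_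
    obtain ⟨g, rfl⟩ := Ideal.Quotient.mk_surjective c
    exact congrArg (Ideal.Quotient.mk _) (Subtype.ext (Subring.mem_center_iff.1 hz g))
  obtain ⟨a, ha⟩ := Algebra.mem_bot.1 (hf.central.out hcenter)
  exact ⟨a, (Ideal.Quotient.eq (I := eigenIdeal (fixedField C D) f)).1 ha.symm⟩

theorem ne_zero_of_centralBinomial_mem_span {a : D} (hft : RightCoprime f X) (hf : ¬ IsUnit f)
    (h : centralBinomial u n a ∈ Ideal.span {f}) : a ≠ 0 := by
  rintro rfl
  have hX := Ideal.mul_mem_left _ (SkewPolynomial.C (u : D)) h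
  rw [C_mul_centralBinomial, mul_zero, C_0, sub_zero] at hX
  exact hf (isUnit_of_X_pow_mem_span hft.coeff_zero_ne_zero hX)

variable [Algebra.IsCentral C D] [FiniteDimensional C D]

theorem IsInnerTwist.isGeneralisedAPolynomial_of_mem_span (H : IsInnerTwist σ u n) (hn : 0 < n)
    {a : D} (ha : IsFixedCentral σ a) (ha0 : a ≠ 0)
    (h : centralBinomial u n a ∈ Ideal.span {f}) (hf : ¬ IsUnit f) :
    IsGeneralisedAPolynomial C f := by
  have := finiteDimensional_fixedField (C := C) H.twist hn H.iterate_eq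
  have : FiniteDimensional (fixedField C D) D := Module.Finite.trans C D
  have := isTwoSided_span_singleton (H.centralBinomial_mem_center ha)
  refine isCentralSimpleAlgebra_eigenring
    (H.isCentralSimpleAlgebra_quotient hn
      (fun _ => exists_algebraMap_fixedField_eq H.twist) ha ha0)
    (π := Ideal.Quotient.mkₐ (fixedField C D) (Ideal.span {centralBinomial u n a}))
    Ideal.Quotient.mk_surjective (fun r hr => ?_) (mt span_singleton_eq_top_iff.1 hf)
  exact (Ideal.span_singleton_le_iff_mem _).2 h (Ideal.Quotient.eq_zero_iff_mem.1 hr)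

theorem IsInnerTwist.isGeneralisedAPolynomial_iff (H : IsInnerTwist σ u n) (hn : 0 < n)
    (hft : RightCoprime f X) (hf : ¬ IsUnit f) :
    IsGeneralisedAPolynomial C f ↔ ∃ a : fixedField C D, a ≠ 0 ∧
      centralBinomial u n (algebraMap (fixedField C D) D a) ∈ Ideal.span {f} := by
  refine ⟨fun h => ?_, fun ⟨a, ha0, ha⟩ => H.isGeneralisedAPolynomial_of_mem_span hn
    (isFixedCentral_algebraMap H.twist a) ((map_ne_zero (algebraMap _ D)).2 ha0) ha hf⟩
  obtain ⟨a, ha⟩ := h.exists_sub_algebraMap_mem_span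
    (centralVar_mem_center H.twist H.iterate_eq H.fixed)
  exact ⟨a, (map_ne_zero (algebraMap _ D)).1 (ne_zero_of_centralBinomial_mem_span hft hf ha), ha⟩

end GeneralisedAPolynomial

section Factorisation

variable {D : Type*} [DivisionRing D] [MulSemiringAction (Multiplicative ℕ) D]
  {σ : D ≃+* D} {u : Dˣ} {n m : ℕ} {a b : D} {f : SkewPolynomial D}

theorem centralBinomial_mem_span_iff :
    centralBinomial u n a ∈ Ideal.span {f} ↔ X ^ n - C (u * a) ∈ Ideal.span {f} := by
  rw [← Ideal.span_singleton_le_iff_mem, span_centralBinomial, Ideal.span_singleton_le_iff_mem]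

theorem centralBinomial_mem_span_X_sub_C_iff (hσ : ∀ x : D, φ x = σ x) :
    centralBinomial u n a ∈ Ideal.span {X - C b} ↔ u * a = skewNorm σ n b := by
  rw [centralBinomial_mem_span_iff, X_pow_sub_C_mem_span_iff hσ]

theorem le_of_centralBinomial_mem_span (hn : 0 < n) (hf : IsMonicOfDegree f m)
    (h : centralBinomial u n a ∈ Ideal.span {f}) : m ≤ n := by
  have hdeg := degree_centralBinomial u hn a
  simpa only [hf.1, hdeg, Nat.cast_le] using
    degree_le_degree_of_mem_span h (ne_zero_of_degree_eq hdeg)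

namespace IsInnerTwist

theorem eq_X_pow_sub_C_of_mem_span (H : IsInnerTwist σ u n) (hn : n.Prime)
    (ha : IsFixedCentral σ a) (ha0 : a ≠ 0) (hb : ∀ b, u * a ≠ skewNorm σ n b)
    (hf : IsMonicOfDegree f m) (hm : 0 < m) (h : centralBinomial u n a ∈ Ideal.span {f}) :
    f = X ^ n - C (u * a) := by
  rcases (le_of_centralBinomial_mem_span hn.pos hf h).eq_or_lt with rfl | hlt
  · exact ((isMonicOfDegree_X_pow_sub_C hm _).eq_of_mem_span hf
      (centralBinomial_mem_span_iff.1 h)).symm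
  · obtain ⟨b, hb'⟩ := (H.isCentralMaximal_centralBinomial hn.pos ha ha0).exists_mem_span_X_sub_C
      hn (degree_centralBinomial u hn.pos a) h hf hm hlt
    exact absurd ((centralBinomial_mem_span_X_sub_C_iff H.twist).1 hb') (hb b)

theorem irreducible_X_pow_sub_C (H : IsInnerTwist σ u n) (hn : n.Prime)
    (ha : IsFixedCentral σ a) (ha0 : a ≠ 0) (hb : ∀ b, u * a ≠ skewNorm σ n b) :
    Irreducible (X ^ n - C (u * a) : SkewPolynomial D) := by
  have hbinom := isMonicOfDegree_X_pow_sub_C hn.pos (u * a)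
  refine ⟨not_isUnit_of_degree_eq hbinom.1 hn.pos, fun p q hpq => ?_⟩
  have hq0 : q ≠ 0 := right_ne_zero_of_mul (hpq ▸ hbinom.ne_zero)
  have hmem : X ^ n - C (u * a) ∈ Ideal.span {q} := Ideal.mem_span_singleton'.2 ⟨p, hpq.symm⟩
  obtain ⟨k, q', hq', hspan⟩ := exists_isMonicOfDegree_span_eq
    (mt Ideal.span_singleton_eq_bot.1 hq0)
  rw [hspan] at hmem
  rcases k.eq_zero_or_pos with rfl | hk
  · rw [isMonicOfDegree_zero_iff.1 hq'] at hspan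
    exact .inr (span_singleton_eq_top_iff.1 (hspan.trans (span_singleton_eq_top_iff.2 isUnit_one)))
  · rw [← centralBinomial_mem_span_iff] at hmem
    rw [H.eq_X_pow_sub_C_of_mem_span hn ha ha0 hb hq' hk hmem, hpq] at hspan
    obtain ⟨s, hs⟩ := Ideal.mem_span_singleton'.1 (hspan ▸ Ideal.mem_span_singleton_self q)
    rw [← mul_assoc, mul_eq_right₀ hq0] at hs
    exact .inl (.of_mul_eq_one_right s hs)

theorem exists_eq_prod_of_mem_span (H : IsInnerTwist σ u n) (hn : 0 < n)
    (ha : IsFixedCentral σ a) (ha0 : a ≠ 0) (hb : u * a = skewNorm σ n b)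
    (hf : IsMonicOfDegree f m) (h : centralBinomial u n a ∈ Ideal.span {f}) :
    ∃ (c : ℕ → Dˣ) (b : Dˣ), c m = 1 ∧ u * a = skewNorm σ n b ∧
      f = ((List.range' 1 m).map fun i => X - C (Omega σ (c i) b)).prod := by
  have hbinom := H.isCentralMaximal_centralBinomial hn ha ha0
  rw [← centralBinomial_mem_span_X_sub_C_iff H.twist] at hb
  obtain ⟨c, hc⟩ := hbinom.exists_eq_prod_X_sub_C_Omega H.twist
    (ne_zero_of_degree_eq (degree_centralBinomial u hn a)) hb h hf
  have hb' : u * a = skewNorm σ n (Omega σ (c m) b) :=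
    (centralBinomial_mem_span_X_sub_C_iff H.twist).1
      (mem_span_X_sub_C_Omega H.twist hbinom.mem_center (c m) hb)
  have hb0 : Omega σ (c m) b ≠ 0 :=
    ne_zero_of_skewNorm_ne_zero hn.ne' (hb' ▸ mul_ne_zero u.ne_zero ha0)
  refine ⟨fun i => c i * (c m)⁻¹, Units.mk0 _ hb0, mul_inv_cancel _, hb', ?_⟩
  simpa only [Units.val_mk0, Omega_mul_inv_Omega] using hc

end IsInnerTwist

theorem pow_mem_span_prod_X_sub_C_Omega (hσ : ∀ x : D, φ x = σ x) {h : SkewPolynomial D}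
    (hh : h ∈ Subring.center (SkewPolynomial D)) (hb : h ∈ Ideal.span {X - C b}) (c : ℕ → Dˣ) :
    h ^ m ∈ Ideal.span {((List.range' 1 m).map fun i => X - C (Omega σ (c i) b)).prod} := by
  simpa only [List.length_map, List.length_range'] using
    pow_length_mem_span_prod hh ((List.range' 1 m).map fun i => X - C (Omega σ (c i) b)) <|
      List.forall_mem_map.2 fun i _ => mem_span_X_sub_C_Omega hσ hh (c i) hb

end Factorisation

section EvalCentral

variable {C D : Type*} [Field C] [DivisionRing D] [Algebra C D]
  [MulSemiringAction (Multiplicative ℕ) D] {u : Dˣ} {n : ℕ}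

theorem evalCentral_X_sub_C (a : fixedField C D) :
    evalCentral u n (Polynomial.X - Polynomial.C a) =
      centralBinomial u n (algebraMap (fixedField C D) D a) := by
  rw [evalCentral, map_sub, Polynomial.aeval_X, Polynomial.aeval_C]
  rfl

theorem evalCentral_mem_of_pow_mem {I : Ideal (SkewPolynomial D)} (hI : I ≠ ⊤)
    {p q : Polynomial (fixedField C D)} (hp : Irreducible p) (hpI : evalCentral u n p ∈ I)
    {k : ℕ} (hqI : evalCentral u n q ^ k ∈ I) : evalCentral u n q ∈ I := by
  by_cases hdvd : p ∣ q ^ k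
  · obtain ⟨r, rfl⟩ := hp.prime.dvd_of_dvd_pow hdvd
    rw [mul_comm, evalCentral, map_mul]
    exact I.mul_mem_left _ hpI
  · obtain ⟨A, B, hAB⟩ := hp.coprime_iff_not_dvd.2 hdvd
    have h1 := congrArg (evalCentral u n) hAB
    simp only [evalCentral, map_add, map_mul, map_one, map_pow] at h1 hpI hqI
    refine absurd ((Ideal.eq_top_iff_one I).2 (h1 ▸ ?_)) hI
    exact I.add_mem (I.mul_mem_left _ hpI) (I.mul_mem_left _ hqI)

theorem IsInnerTwist.centralBinomial_mem_span_prod {σ : D ≃+* D} (H : IsInnerTwist σ u n)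
    {a : fixedField C D} {b : D} (hab : u * algebraMap (fixedField C D) D a = skewNorm σ n b)
    {m : ℕ} {c : ℕ → Dˣ} {f : SkewPolynomial D} (hf : ¬ IsUnit f)
    (hfc : f = ((List.range' 1 m).map fun i => X - SkewPolynomial.C (Omega σ (c i) b)).prod)
    {hhat : Polynomial (fixedField C D)} (hirr : Irreducible hhat)
    (hmul : ∃ g, evalCentral u n hhat = g * f) :
    centralBinomial u n (algebraMap (fixedField C D) D a) ∈ Ideal.span {f} := by
  have hpow := pow_mem_span_prod_X_sub_C_Omega (m := m) H.twist
    (H.centralBinomial_mem_center (isFixedCentral_algebraMap H.twist a))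
    ((centralBinomial_mem_span_X_sub_C_iff H.twist).2 hab) c
  rw [← evalCentral_X_sub_C, ← hfc] at *
  exact evalCentral_mem_of_pow_mem (mt span_singleton_eq_top_iff.1 hf) hirr
    (Ideal.mem_span_singleton'.2 (hmul.imp fun _ => Eq.symm)) hpow

end EvalCentral

section Main

variable {C D : Type*} [Field C] [DivisionRing D] [Algebra C D] [Algebra.IsCentral C D]
  [FiniteDimensional C D] [MulSemiringAction (Multiplicative ℕ) D]
  {σ : D ≃+* D} {u : Dˣ} {n m : ℕ} {f : SkewPolynomial D}

theorem theorem4_general (H : IsInnerTwist σ u n) (hn : n.Prime) (hm : 1 ≤ m)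
    (hf : IsMonicOfDegree f m) (hft : RightCoprime f X)
    {hhat : Polynomial (fixedField C D)} (hirr : Irreducible hhat)
    (hmul : ∃ g, evalCentral u n hhat = g * f) :
    (IsGeneralisedAPolynomial C f ↔
      (∃ a : fixedField C D, a ≠ 0 ∧
        (∀ b : D, u * algebraMap (fixedField C D) D a ≠ skewNorm σ n b) ∧
        f = X ^ n - SkewPolynomial.C (u * algebraMap (fixedField C D) D a)) ∨
      (m ≤ n ∧ ∃ (c : ℕ → Dˣ) (b : Dˣ), c m = 1 ∧
        (∃ a : fixedField C D, a ≠ 0 ∧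
          ((u⁻¹ : Dˣ) : D) * ((List.range n).map fun j => σ^[n - j] (b : D)).prod =
            algebraMap (fixedField C D) D a) ∧
        f = ((List.range' 1 m).map fun i => X - SkewPolynomial.C (Omega σ (c i) b)).prod)) ∧
    (∀ a : fixedField C D, a ≠ 0 →
      (∀ b : D, u * algebraMap (fixedField C D) D a ≠ skewNorm σ n b) →
      f = X ^ n - SkewPolynomial.C (u * algebraMap (fixedField C D) D a) → Irreducible f) := by
  have hfix := isFixedCentral_algebraMap (C := C) H.twist
  have hne {a : fixedField C D} (ha : a ≠ 0) : algebraMap (fixedField C D) D a ≠ 0 :=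
    (map_ne_zero _).2 ha
  have hf1 := not_isUnit_of_degree_eq hf.1 hm
  refine ⟨(H.isGeneralisedAPolynomial_iff hn.pos hft hf1).trans ⟨?_, ?_⟩, ?_⟩
  · rintro ⟨a, ha0, ha⟩
    have hmn := le_of_centralBinomial_mem_span hn.pos hf ha
    by_cases hb : ∃ b, u * algebraMap (fixedField C D) D a = skewNorm σ n b
    · obtain ⟨b, hb⟩ := hb
      obtain ⟨c, b, hcm, hb, hfc⟩ :=
        H.exists_eq_prod_of_mem_span hn.pos (hfix a) (hne ha0) hb hf ha
      exact .inr ⟨hmn, c, b, hcm, ⟨a, ha0, (mul_eq_skewNorm_iff H.fixed (hfix a).2).1 hb⟩, hfc⟩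
    · rw [not_exists] at hb
      exact .inl ⟨a, ha0, hb,
        H.eq_X_pow_sub_C_of_mem_span hn (hfix a) (hne ha0) hb hf hm ha⟩
  · rintro (⟨a, ha0, -, rfl⟩ | ⟨-, c, b, -, ⟨a, ha0, hab⟩, hfc⟩)
    · exact ⟨a, ha0, centralBinomial_mem_span_iff.2 (Ideal.mem_span_singleton_self _)⟩
    · rw [← mul_eq_skewNorm_iff H.fixed (hfix a).2] at hab
      exact ⟨a, ha0, H.centralBinomial_mem_span_prod hab hf1 hfc hirr hmul⟩
  · rintro a ha0 hb rfl
    exact H.irreducible_X_pow_sub_C hn (hfix a) (hne ha0) hb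

end Main

end GenAPoly

theorem theorem4 {C D : Type*} [Field C] [DivisionRing D] [Algebra C D]
    [Algebra.IsCentral C D] [FiniteDimensional C D]
    (d : ℕ) (hd : Module.finrank C D = d ^ 2)
    [MulSemiringAction (Multiplicative ℕ) D]
    (σ : D ≃+* D) (hσ : ∀ x : D, SkewPolynomial.φ x = σ x)
    (n : ℕ) (u : Dˣ)
    (hu : ∀ x : D, σ^[n] x = u * x * (u⁻¹ : Dˣ))
    (hinner : ∀ i : ℕ, 1 ≤ i → i < n → ¬ GenAPoly.IsInner (σ^[i]))
    (hσu : σ u = u)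
    (m : ℕ) (hm : 1 ≤ m) (f : SkewPolynomial D)
    (hdeg : GenAPoly.degree f = m) (hmonic : f.coeff m = 1)
    (hft : GenAPoly.RightCoprime f SkewPolynomial.X)
    (hhat : Polynomial (GenAPoly.fixedField C D))
    (hmin : GenAPoly.IsMinCentralLeftMultiple u n f hhat)
    (hirr : Irreducible hhat)
    (hn : n.Prime) (hnd : n ≠ d) :
    (GenAPoly.IsGeneralisedAPolynomial C f ↔
      (∃ a : GenAPoly.fixedField C D, a ≠ 0 ∧
        (∀ b : D, u * algebraMap (GenAPoly.fixedField C D) D a ≠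
          ((List.range' 1 n).map fun j => σ^[n - j] b).prod) ∧
        f = SkewPolynomial.X ^ n -
          SkewPolynomial.C (u * algebraMap (GenAPoly.fixedField C D) D a)) ∨
      (m ≤ n ∧ ∃ (c : ℕ → Dˣ) (b : Dˣ), c m = 1 ∧
        (∃ a : GenAPoly.fixedField C D, a ≠ 0 ∧
          ((u⁻¹ : Dˣ) : D) * ((List.range n).map fun j => σ^[n - j] (b : D)).prod =
            algebraMap (GenAPoly.fixedField C D) D a) ∧
        f = ((List.range' 1 m).map fun i =>
          SkewPolynomial.X - SkewPolynomial.C (GenAPoly.Omega σ (c i) b)).prod)) ∧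
    (∀ a : GenAPoly.fixedField C D, a ≠ 0 →
      (∀ b : D, u * algebraMap (GenAPoly.fixedField C D) D a ≠
        ((List.range' 1 n).map fun j => σ^[n - j] b).prod) →
      f = SkewPolynomial.X ^ n -
        SkewPolynomial.C (u * algebraMap (GenAPoly.fixedField C D) D a) →
      Irreducible f) :=
  GenAPoly.theorem4_general ⟨hσ, hu, hinner, hσu⟩ hn hm ⟨hdeg, hmonic⟩ hft hirr hmin.leftMultiple
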